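/- All graphs are finite and simple, and classes of graphs are closed under isomorphism; a class is hereditary if it is closed under taking induced subgraphs. A linear ordering $(a_1,\dots,a_\ell)$ of a set of vertices of a graph is good if $|N(a_j)\setminus N(a_i)|\le 1$ for all $i<j$. A quasi-chain graph is a bipartite graph that has a bipartition each of whose two parts admits a good ordering. A graph $G$ is a $k$-letter graph if there are an alphabet $\Omega$ with $k$ letters, a set $\mathcal P\subseteq\Omega^2$ and a word $w_1\cdots w_n$ over $\Omega$ such that $G$ is isomorphic to the graph on $\{1,\dots,n\}$ in which $i<j$ are adjacent if and only if $(w_i,w_j)\in\mathcal P$; the lettericity of $G$ is the least such $k$. Let $\mathcal M$ be the class of graphs of vertex degree at most $1$, and let $\widetilde{\mathcal M}$ be the class of bipartite complements of graphs in $\mathcal M$, where the bipartite complement of a graph with respect to a bipartition $(A,B)$ of its vertices into two independent sets is obtained by exchanging edges and non-edges between $A$ and $B$. Let $Z_n$ be the bipartite graph with vertices $a_1,\dots,a_n,b_1,\dots,b_n$ in which $a_i$ and $b_j$ are adjacent if and only if $i\le j$, let the double-chain graph $D_n$ be obtained from $Z_{3n}$ by deleting all edges $a_ib_{i+1}$ and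 then all vertices whose index is divisible by $3$, and let $\mathcal D$ be the class of all induced subgraphs of the graphs $D_n$, $n\in\mathbb N$. Let $\mathcal X$ be a hereditary class of quasi-chain graphs. Then the lettericity of the graphs in $\mathcal X$ is bounded if and only if $\mathcal X$ excludes at least one graph from each of $\mathcal M$, $\widetilde{\mathcal M}$ and $\mathcal D$. Moreover, $\mathcal M$, $\widetilde{\mathcal M}$ and $\mathcal D$ are exactly the minimal ones among the hereditary classes of quasi-chain graphs of unbounded lettericity. -/

import Mathlib

/-- A finite simple graph, bundled with its vertex set. -/
structure FinGraph : Type 1 where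
  V : Type
  finite : Finite V
  graph : SimpleGraph V

attribute [instance] FinGraph.finite

/-- A class of finite graphs. -/
abbrev GraphClass : Type 1 := Set FinGraph

/-- A class is hereditary if it is closed under taking induced subgraphs. As usual, classes of
graphs are considered up to isomorphism: "`H` is an induced subgraph of `G`" means that there is an
induced embedding of `H` into `G`; in particular a hereditary class is closed under isomorphism. -/
def IsHereditary (X : GraphClass) : Prop :=
  ∀ G ∈ X, ∀ H : FinGraph, H.graph.IsIndContained G.graph → H ∈ X

/-! ### Bipartitions, bipartite complements, quasi-chain graphs -/

/-- `(A, B)` is a bipartition of the vertex set of `G` into two independent sets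
(one of which may be empty). -/
def IsBipartition {V : Type*} (G : SimpleGraph V) (A B : Set V) : Prop :=
  G.IsBipartiteWith A B ∧ A ∪ B = Set.univ

/-- The bipartite complement of `G = (A, B, E)`: vertices `a ∈ A` and `b ∈ B` are adjacent
if and only if they are not adjacent in `G`, and there are no other edges. -/
def bipartiteComplement {V : Type*} (G : SimpleGraph V) (A B : Set V) : SimpleGraph V :=
  Gᶜ.between A B

/-- The list `l = (a₁, …, a_ℓ)` is a good ordering of the set `A` of vertices of `G`: it lists every
element of `A` exactly once, and `|N(a_j) \ N(a_i)| ≤ 1` whenever `i < j`. -/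
def IsGoodOrdering {V : Type*} (G : SimpleGraph V) (A : Set V) (l : List V) : Prop :=
  l.Nodup ∧ (∀ v, v ∈ l ↔ v ∈ A) ∧
    l.Pairwise fun x y => (G.neighborSet y \ G.neighborSet x).ncard ≤ 1

/-- A quasi-chain graph: a bipartite graph with a bipartition each of whose parts admits a good
ordering. -/
def IsQuasiChain {V : Type*} (G : SimpleGraph V) : Prop :=
  ∃ A B : Set V, IsBipartition G A B ∧
    (∃ l, IsGoodOrdering G A l) ∧ (∃ l, IsGoodOrdering G B l)

/-- The class of all quasi-chain graphs. -/
def quasiChainGraphs : GraphClass := {G | IsQuasiChain G.graph}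

/-! ### Letter graphs and lettericity -/

/-- The letter graph of the word `w = w₁ ⋯ wₙ` over the alphabet `Ω` with decoder `P ⊆ Ω²`: for
`i < j`, the positions `i` and `j` are adjacent if and only if `(wᵢ, wⱼ) ∈ P`. -/
def letterGraph {Ω : Type*} (P : Set (Ω × Ω)) {n : ℕ} (w : Fin n → Ω) : SimpleGraph (Fin n) where
  Adj i j := (i < j ∧ (w i, w j) ∈ P) ∨ (j < i ∧ (w j, w i) ∈ P)
  symm := ⟨fun _ _ h => h.symm⟩
  loopless := ⟨fun _ h => h.elim (fun h => lt_irrefl _ h.1) (fun h => lt_irrefl _ h.1)⟩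

/-- `G` is (isomorphic to) a letter graph over some alphabet of `k` letters. -/
def IsLetterGraph {V : Type*} (k : ℕ) (G : SimpleGraph V) : Prop :=
  ∃ (P : Set (Fin k × Fin k)) (n : ℕ) (w : Fin n → Fin k), Nonempty (G ≃g letterGraph P w)

/-- Every finite graph is a letter graph over an alphabet of `|V(G)|` letters, so the minimum in the
definition of `lettericity` is taken over a nonempty set. -/
theorem isLetterGraph_card {V : Type*} [Finite V] (G : SimpleGraph V) :
    IsLetterGraph (Nat.card V) G := by
  let e := Finite.equivFin V
  refine ⟨{p | G.Adj (e.symm p.1) (e.symm p.2)}, Nat.card V, id, ⟨⟨e, ?_⟩⟩⟩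
  intro a b
  simp only [letterGraph, id, Set.mem_ofPred_eq, Equiv.symm_apply_apply]
  constructor
  · rintro (h | h)
    · exact h.2
    · exact h.2.symm
  · intro h
    rcases lt_trichotomy (e a) (e b) with h1 | h1 | h1
    · exact Or.inl ⟨h1, h⟩
    · exact absurd (e.injective h1) h.ne
    · exact Or.inr ⟨h1, h.symm⟩

/-- The lettericity of a finite graph: the least `k` such that the graph is a letter graph over an
alphabet of `k` letters. -/
noncomputable def lettericity (G : FinGraph) : ℕ := sInf {k | IsLetterGraph k G.graph}

/-- A class of graphs has bounded lettericity. -/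
def HasBoundedLettericity (X : GraphClass) : Prop := ∃ k : ℕ, ∀ G ∈ X, lettericity G ≤ k

/-! ### The three classes -/

/-- The class `𝓜` of graphs of vertex degree at most 1 (induced matchings). -/
def inducedMatchings : GraphClass :=
  {G | ∀ v, (G.graph.neighborSet v).ncard ≤ 1}

/-- The class `𝓜̃` of bipartite complements of graphs of vertex degree at most 1. -/
def coMatchings : GraphClass :=
  {H | ∃ (G : SimpleGraph H.V) (A B : Set H.V), (∀ v, (G.neighborSet v).ncard ≤ 1) ∧
    IsBipartition G A B ∧ H.graph = bipartiteComplement G A B}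

/-- The universal chain graph `Z_n` with vertices `a₁, …, aₙ` (left summand) and
`b₁, …, bₙ` (right summand), where `aᵢ` and `bⱼ` are adjacent if and only if `i ≤ j`.
The element `i : Fin n` stands for the index `i + 1`. -/
def chainGraph (n : ℕ) : SimpleGraph (Fin n ⊕ Fin n) where
  Adj
    | Sum.inl i, Sum.inr j => i ≤ j
    | Sum.inr j, Sum.inl i => i ≤ j
    | _, _ => False
  symm := ⟨by rintro (i | i) (j | j) h <;> exact h⟩
  loopless := ⟨by rintro (i | i) h <;> exact h⟩

/-- The index in `{1, …, n}` of a vertex of `Z_n`. -/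
def chainIndex {n : ℕ} : Fin n ⊕ Fin n → ℕ
  | Sum.inl i => i + 1
  | Sum.inr i => i + 1

/-- The double-chain graph `D_n`: in `Z_{3n}` delete all edges of the form `aᵢ b_{i+1}`, and then
delete all vertices whose index is divisible by 3. -/
def doubleChainGraph (n : ℕ) :
    SimpleGraph {v : Fin (3 * n) ⊕ Fin (3 * n) | ¬ 3 ∣ chainIndex v} :=
  ((chainGraph (3 * n)).deleteEdges
    {e | ∃ i j : Fin (3 * n), (j : ℕ) = i + 1 ∧ e = s(Sum.inl i, Sum.inr j)}).induce
      {v | ¬ 3 ∣ chainIndex v}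

/-- The class `𝓓` of all double-chain graphs `D_n` and all their induced subgraphs. -/
def doubleChains : GraphClass :=
  {G | ∃ n : ℕ, G.graph.IsIndContained (doubleChainGraph n)}

/-- `X` is a minimal hereditary class of unbounded lettericity: it is hereditary, lettericity is
unbounded on it, and it is bounded on every proper hereditary subclass. -/
def IsMinimalUnbounded (X : GraphClass) : Prop :=
  IsHereditary X ∧ ¬ HasBoundedLettericity X ∧
    ∀ Y : GraphClass, IsHereditary Y → Y ⊂ X → HasBoundedLettericity Y

/-! Upper bound. A quasi-chain graph is a relation `R` between its parts in which any two
neighbourhoods are nested up to one element. Sort the columns by degree, and let the threshold of a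
row of degree `d` cut off its last `d` columns: this is a chain relation. If `p`-matchings and
`p`-co-matchings are absent, every row and every column disagrees with it in at most `2 * p` places
(`exists_chain_with_bounded_difference`).

Next cut the common order of rows and columns greedily into minimal blocks containing an induced
2K₂. Disagreements are sparse, so many blocks can be thinned out to a long double chain
(`hasDoubleChain_of_blocks`). With few blocks there are few segments, each 2K₂-free and hence
exactly a chain. Across any one cut, many disagreements would contain an induced matching of
disagreements, which is a large matching or co-matching of `R`. So `R` is a chain relation with
boundedly many exceptions (`exists_chain_with_few_exceptions`). Two letters encode the chain, and
each vertex in an exception receives a letter of its own.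

Lower bound. By pigeonhole, a long matching, co-matching or double chain contains two indices with
the same letters. Comparing positions in the word then forces a wrong adjacency, or, for double
chains, a cyclic inequality.

Minimality follows because none of the three classes contains another: a proper hereditary subclass
of one misses a graph of that class and also excludes a small member of each of the other two. -/

/-! ### Quasi-chain relations and the three forbidden patterns. -/

section RelationCore

variable {α β : Type*}

/-- The bipartite graph of `R` contains an induced matching with `k` edges. -/
def HasMatching (R : α → β → Prop) (k : ℕ) : Prop :=
  ∃ (f : Fin k → α) (g : Fin k → β), ∀ i j, R (f i) (g j) ↔ i = j

/-- The bipartite graph of `R` contains the bipartite complement of a matching with `k` edges. -/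
def HasCoMatching (R : α → β → Prop) (k : ℕ) : Prop :=
  ∃ (f : Fin k → α) (g : Fin k → β), ∀ i j, R (f i) (g j) ↔ i ≠ j

/-- The bipartite graph of `R` contains `k` induced copies of `2K₂`, consecutively joined as in a
chain graph. -/
def HasDoubleChain (R : α → β → Prop) (k : ℕ) : Prop :=
  ∃ (x y : Fin k → α) (u v : Fin k → β), ∀ i j,
    (R (x i) (u j) ↔ i ≤ j) ∧ (R (y i) (v j) ↔ i ≤ j) ∧
    (R (x i) (v j) ↔ i < j) ∧ (R (y i) (u j) ↔ i < j)

theorem HasMatching.mono {R : α → β → Prop} {k l : ℕ} (h : HasMatching R l) (hkl : k ≤ l) :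
    HasMatching R k := by
  obtain ⟨f, g, hfg⟩ := h
  exact ⟨f ∘ Fin.castLE hkl, g ∘ Fin.castLE hkl, fun i j => by simp [hfg]⟩

theorem HasCoMatching.mono {R : α → β → Prop} {k l : ℕ} (h : HasCoMatching R l) (hkl : k ≤ l) :
    HasCoMatching R k := by
  obtain ⟨f, g, hfg⟩ := h
  exact ⟨f ∘ Fin.castLE hkl, g ∘ Fin.castLE hkl, fun i j => by simp [hfg]⟩

theorem HasDoubleChain.mono {R : α → β → Prop} {k l : ℕ} (h : HasDoubleChain R l) (hkl : k ≤ l) :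
    HasDoubleChain R k := by
  obtain ⟨x, y, u, v, h⟩ := h
  exact ⟨x ∘ Fin.castLE hkl, y ∘ Fin.castLE hkl, u ∘ Fin.castLE hkl, v ∘ Fin.castLE hkl,
    fun i j => by simpa using h (Fin.castLE hkl i) (Fin.castLE hkl j)⟩

theorem hasMatching_of_finset {ι : Type*} {R : α → β → Prop} {S : Finset ι} {f : ι → α}
    {g : ι → β} (h : ∀ i ∈ S, ∀ j ∈ S, R (f i) (g j) ↔ i = j) {k : ℕ} (hk : k ≤ S.card) :
    HasMatching R k := by
  refine HasMatching.mono ⟨fun i => f (S.equivFin.symm i), fun i => g (S.equivFin.symm i),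
    fun i j => ?_⟩ hk
  rw [h _ (S.equivFin.symm i).2 _ (S.equivFin.symm j).2]
  simp

theorem hasCoMatching_of_finset {ι : Type*} {R : α → β → Prop} {S : Finset ι} {f : ι → α}
    {g : ι → β} (h : ∀ i ∈ S, ∀ j ∈ S, R (f i) (g j) ↔ i ≠ j) {k : ℕ} (hk : k ≤ S.card) :
    HasCoMatching R k := by
  refine HasCoMatching.mono ⟨fun i => f (S.equivFin.symm i), fun i => g (S.equivFin.symm i),
    fun i j => ?_⟩ hk
  rw [h _ (S.equivFin.symm i).2 _ (S.equivFin.symm j).2]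
  simp

/-- `N(y) \ N(x)` has at most one element. -/
def AlmostNested (R : α → β → Prop) (x y : α) : Prop :=
  ∀ b b', R y b → ¬ R x b → R y b' → ¬ R x b' → b = b'

open scoped Classical in
/-- The number of elements of `β` related to `a`. -/
noncomputable def relDegree [Fintype β] (R : α → β → Prop) (a : α) : ℕ :=
  (Finset.univ.filter (R a)).card

/-- From |N(y)| ≤ |N(x)| follows |N(y) \ N(x)| ≤ |N(x) \ N(y)|. Hence degree alone decides the
direction of nesting, and the given good orderings can be forgotten. -/
theorem almostNested_of_relDegree_le [Fintype β] {R : α → β → Prop} {x y : α}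
    (h : AlmostNested R x y ∨ AlmostNested R y x) (hd : relDegree R y ≤ relDegree R x) :
    AlmostNested R x y := by
  classical
  rcases h with h | h
  · exact h
  · have h1 : (Finset.univ.filter (R x) \ Finset.univ.filter (R y)).card ≤ 1 := by
      rw [Finset.card_le_one]
      intro b hb b' hb'
      simp only [Finset.mem_sdiff, Finset.mem_filter, Finset.mem_univ, true_and] at hb hb'
      exact h b b' hb.1 hb.2 hb'.1 hb'.2
    have h2 : (Finset.univ.filter (R y) \ Finset.univ.filter (R x)).card ≤ 1 :=
      (Finset.card_sdiff_le_card_sdiff_iff.2 (by simpa only [relDegree] using hd)).trans h1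
    rw [Finset.card_le_one] at h2
    intro b b' hb hxb hb' hxb'
    exact h2 b (by simp [hb, hxb]) b' (by simp [hb', hxb'])

/-- A finite set can be enumerated in the order given by a key. -/
theorem exists_equiv_fin_of_key {V L : Type*} [Fintype V] [LinearOrder L] (f : V → L) :
    ∃ e : V ≃ Fin (Fintype.card V), ∀ u v, f u < f v → e u < e v := by
  classical
  let e₀ := Fintype.equivFin V
  let σ := Tuple.sort (f ∘ e₀.symm)
  have hσ : Monotone ((f ∘ e₀.symm) ∘ σ) := Tuple.monotone_sort _
  refine ⟨e₀.trans σ.symm, fun u v huv => ?_⟩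
  by_contra hlt
  have := hσ (not_lt.1 hlt)
  simp at this
  exact absurd huv (not_lt.2 this)

/-- Two `R`-neighbourhoods are almost nested in one of the two orders, on both sides. -/
def IsQuasiChainRel (R : α → β → Prop) : Prop :=
  (∀ x y, AlmostNested R x y ∨ AlmostNested R y x) ∧
    ∀ x y, AlmostNested (flip R) x y ∨ AlmostNested (flip R) y x

/-! ### Comparison with the threshold relation given by degrees. -/

section Threshold

variable [Fintype β] {R : α → β → Prop} {e : β ≃ Fin (Fintype.card β)}

theorem card_filter_threshold (e : β ≃ Fin (Fintype.card β)) {d : ℕ} (hd : d ≤ Fintype.card β) :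
    (Finset.univ.filter fun b => Fintype.card β ≤ e b + d).card = d := by
  conv_rhs => rw [← Finset.card_range d]
  refine Finset.card_bij (fun b _ => Fintype.card β - 1 - e b) (fun b hb => ?_)
    (fun b _ b' _ h => ?_) (fun i hi => ?_)
  · have := (e b).2
    simp at hb ⊢
    omega
  · have h1 := (e b).2
    have h2 := (e b').2
    exact e.injective (Fin.ext (by omega))
  · have := Finset.mem_range.1 hi
    refine ⟨e.symm ⟨Fintype.card β - 1 - i, by omega⟩, ?_, ?_⟩
    · simp
      omega
    · simp
      omega

open scoped Classical in
-- The ones of row `a` and the columns right of its threshold are sets of equal size, so their two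
-- differences have equal size. Misplaced zeros and misplaced ones therefore come in equal numbers.
theorem card_zeros_eq_card_ones (e : β ≃ Fin (Fintype.card β)) (a : α) :
    (Finset.univ.filter fun b => Fintype.card β ≤ e b + relDegree R a ∧ ¬ R a b).card =
      (Finset.univ.filter fun b => e b + relDegree R a < Fintype.card β ∧ R a b).card := by
  have h := Finset.card_sdiff_comm (card_filter_threshold e
    (d := relDegree R a) (Finset.card_le_univ _) : _ = (Finset.univ.filter (R a)).card)
  convert h using 2
  · ext b
    simp
  · ext b
    simp [and_comm]

open scoped Classical in
theorem exists_zero_and_one (e : β ≃ Fin (Fintype.card β)) (a : α) (b : β)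
    (h : ¬ (R a b ↔ Fintype.card β ≤ e b + relDegree R a)) :
    ∃ b' b'', (Fintype.card β ≤ e b' + relDegree R a ∧ ¬ R a b') ∧
      e b'' + relDegree R a < Fintype.card β ∧ R a b'' := by
  have hc := card_zeros_eq_card_ones (R := R) e a
  by_cases hab : R a b
  · have h1 : e b + relDegree R a < Fintype.card β := by
      by_contra h2
      exact h ⟨fun _ => not_lt.1 h2, fun _ => hab⟩
    have h2 : 0 < (Finset.univ.filter fun b => e b + relDegree R a < Fintype.card β ∧ R a b).card :=
      Finset.card_pos.2 ⟨b, by simp [h1, hab]⟩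
    rw [← hc] at h2
    obtain ⟨b', hb'⟩ := Finset.card_pos.1 h2
    exact ⟨b', b, by simpa using hb', h1, hab⟩
  · have h1 : Fintype.card β ≤ e b + relDegree R a := by
      by_contra h2
      exact h ⟨fun h3 => absurd h3 hab, fun h3 => absurd h3 h2⟩
    have h2 : 0 < (Finset.univ.filter
        fun b => Fintype.card β ≤ e b + relDegree R a ∧ ¬ R a b).card :=
      Finset.card_pos.2 ⟨b, by simp [h1, hab]⟩
    rw [hc] at h2
    obtain ⟨b', hb'⟩ := Finset.card_pos.1 h2
    exact ⟨b, b', ⟨h1, hab⟩, by simpa using hb'⟩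

variable [Fintype α]

/-- Of a zero left of the threshold and a one right of it, the first column dominates the second
one outside of the row considered. -/
theorem threshold_dominates (hR : IsQuasiChainRel R)
    (he : ∀ b b', relDegree (flip R) b < relDegree (flip R) b' → e b < e b') {a s : α} {b b' : β}
    (hb : Fintype.card β ≤ e b + relDegree R a) (hab : ¬ R a b)
    (hb' : e b' + relDegree R a < Fintype.card β) (hab' : R a b') (hs : R s b') (hsb : ¬ R s b) :
    s = a := by
  have hlt : e b' < e b := by
    rw [Fin.lt_def]
    omega
  have hdeg : relDegree (flip R) b' ≤ relDegree (flip R) b := by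
    by_contra h
    exact absurd (he _ _ (not_le.1 h)) (not_lt.2 hlt.le)
  exact almostNested_of_relDegree_le (hR.2 b b') hdeg s a hs hsb hab' hab

open scoped Classical in
-- For a misplaced zero `b` and a misplaced one `b'` of row `a`, some row `s b b'` contains `b` but
-- not `b'`. If for one `b` all these rows have degree at least that of `a`, each misses only `b'`
-- among the ones of `a`, which gives a co-matching on `O`. Otherwise every `b` has such a row of
-- smaller degree, whose only element outside row `a` is `b`, which gives a matching on `Z`.
theorem card_row_zeros_lt (hR : IsQuasiChainRel R)
    (he : ∀ b b', relDegree (flip R) b < relDegree (flip R) b' → e b < e b') {p : ℕ}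
    (hM : ¬ HasMatching R p) (hC : ¬ HasCoMatching R p) (a : α) :
    (Finset.univ.filter fun b => Fintype.card β ≤ e b + relDegree R a ∧ ¬ R a b).card < p := by
  set Z := Finset.univ.filter fun b => Fintype.card β ≤ e b + relDegree R a ∧ ¬ R a b with hZ
  set O := Finset.univ.filter fun b => e b + relDegree R a < Fintype.card β ∧ R a b with hO
  have hc : Z.card = O.card := card_zeros_eq_card_ones e a
  by_contra! hp
  have hdom : ∀ b ∈ Z, ∀ b' ∈ O, ∀ s, R s b' → ¬ R s b → s = a := by
    intro b hb b' hb' s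
    simp only [hZ, hO, Finset.mem_filter, Finset.mem_univ, true_and] at hb hb'
    exact threshold_dominates hR he hb.1 hb.2 hb'.1 hb'.2
  have hZR : ∀ b ∈ Z, ¬ R a b := fun b hb => by simp [hZ] at hb; exact hb.2
  have hOR : ∀ b ∈ O, R a b := fun b hb => by simp [hO] at hb; exact hb.2
  have hs : ∀ b b', ∃ s, b ∈ Z → b' ∈ O → R s b ∧ ¬ R s b' := by
    intro b b'
    by_cases hb : b ∈ Z
    · by_cases hb' : b' ∈ O
      -- Otherwise column `b` would be properly contained in column `b'`, as row `a` belongs only to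
      -- the latter, and the order by degree would put `b` first.
      · by_contra! hno
        have hsub : Finset.univ.filter (flip R b) ⊂ Finset.univ.filter (flip R b') := by
          rw [Finset.ssubset_iff_of_subset]
          · exact ⟨a, by simpa [flip] using hOR b' hb', by simpa [flip] using hZR b hb⟩
          · intro s hs
            simp only [Finset.mem_filter, Finset.mem_univ, true_and, flip] at hs ⊢
            exact (hno s).2.2 hs
        have hlt := he b b' (Finset.card_lt_card hsub)
        simp only [hZ, hO, Finset.mem_filter, Finset.mem_univ, true_and] at hb hb'
        rw [Fin.lt_def] at hlt
        omega
      · exact ⟨a, fun _ h => absurd h hb'⟩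
    · exact ⟨a, fun h => absurd h hb⟩
  choose s hs using hs
  have hsa : ∀ b ∈ Z, ∀ b' ∈ O, s b b' ≠ a := by
    intro b hb b' hb' h
    have := (hs b b' hb hb').1
    rw [h] at this
    exact hZR b hb this
  by_cases hcase : ∃ b ∈ Z, ∀ b' ∈ O, relDegree R a ≤ relDegree R (s b b')
  · obtain ⟨b, hb, hdeg⟩ := hcase
    refine hC (hasCoMatching_of_finset (S := O) (f := s b) (g := id) ?_ (hc ▸ hp))
    intro i hi j hj
    constructor
    · rintro h rfl
      exact (hs b i hb hi).2 h
    · intro hij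
      by_contra h
      exact hij (almostNested_of_relDegree_le (hR.1 _ _) (hdeg i hi) i j (hOR i hi)
        (hs b i hb hi).2 (hOR j hj) h)
  · push Not at hcase
    choose! t ht hdeg using hcase
    refine hM (hasMatching_of_finset (S := Z) (f := fun b => s b (t b)) (g := id) ?_ hp)
    intro i hi j hj
    constructor
    · intro h
      exact almostNested_of_relDegree_le (hR.1 a (s i (t i))) (hdeg i hi).le i j
        (hs i _ hi (ht i hi)).1 (hZR i hi) h (hZR j hj)
    · rintro rfl
      exact (hs i _ hi (ht i hi)).1

open scoped Classical in
-- Each row with a misplaced zero in column `b` also has a misplaced one. By `threshold_dominates`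
-- no other of these rows contains that one, so the pairs form a matching.
theorem card_column_zeros_lt (hR : IsQuasiChainRel R)
    (he : ∀ b b', relDegree (flip R) b < relDegree (flip R) b' → e b < e b') {p : ℕ}
    (hM : ¬ HasMatching R p) (b : β) :
    (Finset.univ.filter fun a => Fintype.card β ≤ e b + relDegree R a ∧ ¬ R a b).card < p := by
  set Z := Finset.univ.filter fun a => Fintype.card β ≤ e b + relDegree R a ∧ ¬ R a b with hZ
  by_contra! hp
  have h : ∀ a ∈ Z, ∃ b', e b' + relDegree R a < Fintype.card β ∧ R a b' := by
    intro a ha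
    simp only [hZ, Finset.mem_filter, Finset.mem_univ, true_and] at ha
    obtain ⟨_, b', -, hb'⟩ := exists_zero_and_one e a b (fun h => ha.2 (h.2 ha.1))
    exact ⟨b', hb'⟩
  have : Nonempty β := ⟨b⟩
  choose! g hg using h
  refine hM (hasMatching_of_finset (S := Z) (f := id) (g := g) ?_ hp)
  intro i hi j hj
  have hgj := hg j hj
  simp only [hZ, Finset.mem_filter, Finset.mem_univ, true_and] at hi hj
  constructor
  · intro h
    exact threshold_dominates hR he hj.1 hj.2 hgj.1 hgj.2 h hi.2
  · rintro rfl
    exact hgj.2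

open scoped Classical in
-- Dually, each row with a misplaced one in column `b` has a misplaced zero, which all the other
-- such rows contain.
theorem card_column_ones_lt (hR : IsQuasiChainRel R)
    (he : ∀ b b', relDegree (flip R) b < relDegree (flip R) b' → e b < e b') {p : ℕ}
    (hC : ¬ HasCoMatching R p) (b : β) :
    (Finset.univ.filter fun a => e b + relDegree R a < Fintype.card β ∧ R a b).card < p := by
  set O := Finset.univ.filter fun a => e b + relDegree R a < Fintype.card β ∧ R a b with hO
  by_contra! hp
  have h : ∀ a ∈ O, ∃ b', Fintype.card β ≤ e b' + relDegree R a ∧ ¬ R a b' := by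
    intro a ha
    simp only [hO, Finset.mem_filter, Finset.mem_univ, true_and] at ha
    obtain ⟨b', _, hb', -⟩ := exists_zero_and_one e a b
      (fun h => absurd (h.1 ha.2) (not_le.2 ha.1))
    exact ⟨b', hb'⟩
  have : Nonempty β := ⟨b⟩
  choose! g hg using h
  refine hC (hasCoMatching_of_finset (S := O) (f := id) (g := g) ?_ hp)
  intro i hi j hj
  have hgj := hg j hj
  simp only [hO, Finset.mem_filter, Finset.mem_univ, true_and] at hi hj
  constructor
  · rintro h rfl
    exact hgj.2 h
  · intro hij
    by_contra h
    exact hij (threshold_dominates hR he hgj.1 hgj.2 hj.1 hj.2 hi.2 h)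

end Threshold

open scoped Classical in
/-- Without large matchings and their complements, a quasi-chain relation differs from a chain
relation by a relation of bounded degree. -/
theorem exists_chain_with_bounded_difference [Fintype α] [Fintype β] {R : α → β → Prop}
    (hR : IsQuasiChainRel R) {p : ℕ} (hM : ¬ HasMatching R p) (hC : ¬ HasCoMatching R p) :
    ∃ (ka : α → ℕ) (kb : β → ℕ), (∀ a b, ka a ≠ kb b) ∧
      (∀ a, (Finset.univ.filter fun b => ¬ (R a b ↔ ka a < kb b)).card ≤ 2 * p) ∧
      (∀ b, (Finset.univ.filter fun a => ¬ (R a b ↔ ka a < kb b)).card ≤ 2 * p) := by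
  obtain ⟨e, he⟩ := exists_equiv_fin_of_key (relDegree (flip R))
  -- Even keys for rows and odd keys for columns never coincide, and their comparison is exactly the
  -- threshold condition.
  have hkey : ∀ a b, 2 * (Fintype.card β - relDegree R a) < 2 * (e b : ℕ) + 1 ↔
      Fintype.card β ≤ e b + relDegree R a := fun a b => by omega
  refine ⟨fun a => 2 * (Fintype.card β - relDegree R a), fun b => 2 * (e b : ℕ) + 1,
    fun a b => by dsimp only; omega, fun a => ?_, fun b => ?_⟩
  · have h1 := card_row_zeros_lt hR he hM hC a
    have h2 := h1
    rw [card_zeros_eq_card_ones] at h2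
    refine (Finset.card_le_card ?_).trans ((Finset.card_union_le _ _).trans
      ((Nat.add_le_add h1.le h2.le).trans (two_mul p).ge))
    intro b
    simp only [hkey, Finset.mem_filter, Finset.mem_union, Finset.mem_univ, true_and,
      ← not_le]
    tauto
  · have h1 := card_column_zeros_lt hR he hM b
    have h2 := card_column_ones_lt hR he hC b
    refine (Finset.card_le_card ?_).trans ((Finset.card_union_le _ _).trans
      ((Nat.add_le_add h1.le h2.le).trans (two_mul p).ge))
    intro a
    simp only [hkey, Finset.mem_filter, Finset.mem_union, Finset.mem_univ, true_and,
      ← not_le]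
    tauto

end RelationCore

/-! ### Cutting the order into segments and bounding the exceptions. -/

section Segmentation

/-- Greedy selection of pairwise non-conflicting elements. -/
theorem exists_independent {ι : Type*} [DecidableEq ι] (C : ι → ι → Prop) [DecidableRel C]
    (D p : ℕ) (E : Finset ι) (hE : ∀ i ∈ E, (E.filter fun j => C i j ∨ C j i).card ≤ D)
    (hp : p * (D + 1) ≤ E.card) :
    ∃ S ⊆ E, S.card = p ∧ ∀ i ∈ S, ∀ j ∈ S, i ≠ j → ¬ C i j := by
  induction p generalizing E with
  | zero => exact ⟨∅, by simp⟩
  | succ p ih =>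
    rw [Nat.succ_mul] at hp
    obtain ⟨i, hi⟩ : E.Nonempty := Finset.card_pos.1 (by omega)
    set F := E.filter fun j => C i j ∨ C j i with hF
    set E' := E \ insert i F with hE'
    have hsub : E' ⊆ E := Finset.sdiff_subset
    have hcard : p * (D + 1) ≤ E'.card := by
      have h1 := Finset.le_card_sdiff (insert i F) E
      have h2 := Finset.card_insert_le i F
      have h3 : F.card ≤ D := hE i hi
      have h4 : E'.card = (E \ insert i F).card := rfl
      omega
    obtain ⟨S, hS, hSp, hSC⟩ := ih E'
      (fun j hj => (Finset.card_le_card (Finset.filter_subset_filter _ hsub)).trans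
        (hE j (hsub hj))) hcard
    have hiS : i ∉ S := fun h => by simpa [hE'] using hS h
    have hC : ∀ j ∈ S, ¬ C i j ∧ ¬ C j i := by
      intro j hj
      have h1 := hS hj
      simp only [hE', hF, Finset.mem_sdiff, Finset.mem_insert, Finset.mem_filter] at h1
      tauto
    refine ⟨insert i S, Finset.insert_subset hi (hS.trans hsub), by simp [hiS, hSp], ?_⟩
    intro j hj k hk hjk
    rcases Finset.mem_insert.1 hj with rfl | hj
    · rcases Finset.mem_insert.1 hk with rfl | hk
      · exact absurd rfl hjk
      · exact (hC k hk).1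
    · rcases Finset.mem_insert.1 hk with h | hk
      · exact h ▸ (hC j hj).2
      · exact hSC j hj k hk hjk

/-- Cutting a finite set along a key: either there are many consecutive bad blocks, or the set falls
into few consecutive good segments. -/
theorem exists_blocks_or_segments {V : Type*} [Finite V] (key : V → ℕ) (Bad : Set V → Prop)
    (hmono : ∀ S T, S ⊆ T → Bad S → Bad T) (hconst : ∀ t, ¬ Bad {v | key v = t}) (P s : ℕ) :
    (∃ S : Fin P → Set V, (∀ i, Bad (S i)) ∧ (∀ i, ∀ v ∈ S i, s ≤ key v) ∧
      ∀ i j, i < j → ∀ u ∈ S i, ∀ v ∈ S j, key u < key v) ∨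
    ∃ seg : V → ℕ, (∀ v, seg v < 2 * P) ∧ (∀ u v, key u ≤ key v → seg u ≤ seg v) ∧
      ∀ c, ¬ Bad {v | s ≤ key v ∧ seg v = c} := by
  classical
  induction P generalizing s with
  | zero => exact Or.inl ⟨Fin.elim0, fun i => i.elim0, fun i => i.elim0, fun i => i.elim0⟩
  | succ P ih =>
    by_cases h : ∃ t, Bad {v | s ≤ key v ∧ key v ≤ t}
    -- The first block ends at the least `t` that makes it bad; the search resumes at `t + 1`.
    · have ht := Nat.find_spec h
      have hmin := fun m => Nat.find_min h (m := m)
      set t := Nat.find h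
      rcases ih (t + 1) with ⟨S, hS, hSs, hSk⟩ | ⟨seg, hseg, hsegm, hgood⟩
      · have hst : s ≤ t := by
          by_contra hst
          refine hconst s (hmono _ _ ?_ ht)
          rintro v ⟨h1, h2⟩
          omega
        refine Or.inl ⟨Fin.cons {v | s ≤ key v ∧ key v ≤ t} S, ?_, ?_, ?_⟩
        · intro i
          refine Fin.cases ?_ (fun i => ?_) i
          · exact ht
          · exact hS i
        · intro i
          refine Fin.cases ?_ (fun i => ?_) i
          · exact fun v hv => hv.1
          · intro v hv
            have := hSs i v hv
            omega
        · intro i j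
          refine Fin.cases ?_ (fun i => ?_) i
          · refine Fin.cases ?_ (fun j => ?_) j
            · simp
            · intro _ u hu v hv
              have h1 := hSs j v hv
              have h2 : key u ≤ t := hu.2
              omega
          · refine Fin.cases ?_ (fun j => ?_) j
            · simp
            · intro hij
              exact hSk i j (by simpa using hij)
      -- A block splits into two good segments: the keys below `t`, good by minimality, and the
      -- single key `t`, good by `hconst`. Hence the factor 2 in `2 * P`.
      · refine Or.inr ⟨fun v => if key v < t then 0 else if key v = t then 1 else seg v + 2,
          ?_, ?_, ?_⟩
        · intro v
          have := hseg v
          dsimp only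
          split_ifs <;> omega
        · intro u v huv
          have := hsegm u v huv
          dsimp only
          split_ifs <;> omega
        · intro c hc
          match c with
          | 0 =>
            -- For `t = 0` there is no `t - 1` to appeal to, but then the block itself has the
            -- single key 0.
            rcases Nat.eq_zero_or_pos t with h0 | h0
            · refine hconst 0 (hmono _ _ ?_ ht)
              rintro v ⟨h1, h2⟩
              simp
              omega
            · refine hmin (t - 1) (by omega) (hmono _ _ ?_ hc)
              rintro v ⟨h1, h2⟩
              refine ⟨h1, ?_⟩
              dsimp only at h2
              split_ifs at h2
              omega
          | 1 =>
            refine hconst t (hmono _ _ ?_ hc)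
            rintro v ⟨h1, h2⟩
            dsimp only at h2
            change key v = t
            split_ifs at h2 <;> omega
          | c + 2 =>
            refine hgood c (hmono _ _ ?_ hc)
            rintro v ⟨h1, h2⟩
            dsimp only at h2
            change t + 1 ≤ key v ∧ seg v = c
            split_ifs at h2 <;> omega
    · refine Or.inr ⟨fun _ => 0, fun _ => by dsimp only; omega, fun _ _ _ => le_rfl, fun c hc => h ?_⟩
      obtain ⟨t, ht⟩ := (Set.finite_range key).bddAbove
      exact ⟨t, hmono _ _ (fun v hv => ⟨hv.1, ht ⟨v, rfl⟩⟩) hc⟩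

variable {α β : Type*}

/-- The set `S` contains an induced `2K₂` of the bipartite graph of `R`. -/
def ContainsTwoK₂ (R : α → β → Prop) (S : Set (α ⊕ β)) : Prop :=
  ∃ x y u v, Sum.inl x ∈ S ∧ Sum.inl y ∈ S ∧ Sum.inr u ∈ S ∧ Sum.inr v ∈ S ∧
    R x u ∧ R y v ∧ ¬ R x v ∧ ¬ R y u

open scoped Classical in
/-- A relation without induced `2K₂` is a chain relation. -/
theorem exists_chain_of_not_containsTwoK₂ [Fintype α] [Fintype β] (R : α → β → Prop)
    (sa : α → ℕ) (sb : β → ℕ)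
    (h : ∀ c, ¬ ContainsTwoK₂ R {v | Sum.elim sa sb v = c}) :
    ∃ (ra : α → ℕ) (rb : β → ℕ), ∀ a b, sa a = sb b → (R a b ↔ ra a < rb b) := by
  -- Within a segment, `ra a` counts the rows strictly above `a` in the neighbourhood order and `rb
  -- b` counts the rows adjacent to `b`. If `R a b`, the latter include the former and also `a`. If
  -- not, 2K₂-freeness puts every row adjacent to `b` strictly above `a`.
  refine ⟨fun a => (Finset.univ.filter fun a' => sa a' = sa a ∧
      (∀ b, sb b = sa a → R a b → R a' b) ∧ ∃ b, sb b = sa a ∧ R a' b ∧ ¬ R a b).card,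
    fun b => (Finset.univ.filter fun a' => sa a' = sb b ∧ R a' b).card, fun a b hab => ?_⟩
  constructor
  · intro hR
    apply Finset.card_lt_card
    rw [Finset.ssubset_iff_of_subset]
    · exact ⟨a, by simp [hab, hR], by simp⟩
    · intro a'
      simp only [Finset.mem_filter, Finset.mem_univ, true_and]
      rintro ⟨h1, h2, -⟩
      exact ⟨h1.trans hab, h2 b hab.symm hR⟩
  · intro hlt
    by_contra hR
    refine absurd hlt (not_lt.2 (Finset.card_le_card ?_))
    intro a'
    simp only [Finset.mem_filter, Finset.mem_univ, true_and]
    rintro ⟨h1, h2⟩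
    refine ⟨h1.trans hab.symm, fun b' hb' hab' => ?_, b, hab.symm, h2, hR⟩
    by_contra h3
    exact h (sb b) ⟨a, a', b', b, hab, h1, hb'.trans hab, rfl, hab', h2, hR, h3⟩

open scoped Classical in
/-- A large set of pairs in a bipartite relation of bounded degree contains a large induced
matching. -/
theorem exists_induced_pairs [Fintype α] [Fintype β] (Q : α → β → Prop) (d p : ℕ)
    (hrow : ∀ a, (Finset.univ.filter fun b => Q a b).card ≤ d)
    (hcol : ∀ b, (Finset.univ.filter fun a => Q a b).card ≤ d)
    (E : Finset (α × β)) (hE : ∀ q ∈ E, Q q.1 q.2) (hp : p * (2 * d ^ 2 + 1) ≤ E.card) :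
    ∃ S ⊆ E, S.card = p ∧ ∀ q ∈ S, ∀ r ∈ S, q ≠ r → ¬ Q q.1 r.2 := by
  -- A pair in conflict with `q` is reached from `q.1` or from `q.2` by two steps along `Q`, with at
  -- most `d` choices each: `d * d` pairs from either end.
  refine exists_independent (fun q r => Q q.1 r.2) (2 * d ^ 2) p E (fun q hq => ?_) hp
  have h1 : ((Finset.univ.filter fun b => Q q.1 b).biUnion fun b =>
      (Finset.univ.filter fun a => Q a b).image fun a => (a, b)).card ≤ d * d :=
    (Finset.card_biUnion_le_card_mul _ _ d
      (fun b _ => Finset.card_image_le.trans (hcol b))).trans (Nat.mul_le_mul_right d (hrow q.1))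
  have h2 : ((Finset.univ.filter fun a => Q a q.2).biUnion fun a =>
      (Finset.univ.filter fun b => Q a b).image fun b => (a, b)).card ≤ d * d :=
    (Finset.card_biUnion_le_card_mul _ _ d
      (fun b _ => Finset.card_image_le.trans (hrow b))).trans (Nat.mul_le_mul_right d (hcol q.2))
  refine (Finset.card_le_card ?_).trans ((Finset.card_union_le _ _).trans
    ((Nat.add_le_add h1 h2).trans (by rw [pow_two, two_mul])))
  rintro ⟨a, b⟩ hab
  obtain ⟨hab, hc⟩ := Finset.mem_filter.1 hab
  have := hE _ hab
  rw [Finset.mem_union, Finset.mem_biUnion, Finset.mem_biUnion]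
  rcases hc with hc | hc
  · exact Or.inl ⟨b, by simpa using hc, by simpa using this⟩
  · exact Or.inr ⟨a, by simpa using hc, by simpa using this⟩

/-! ### Disagreements between different blocks or segments. -/

section Crossing

variable [Fintype α] [Fintype β] {R : α → β → Prop} {ka : α → ℕ} {kb : β → ℕ} {d p : ℕ}

open scoped Classical in
/-- Consecutive blocks containing `2K₂` yield a double chain. -/
theorem hasDoubleChain_of_blocks
    (hrow : ∀ a, (Finset.univ.filter fun b => ¬ (R a b ↔ ka a < kb b)).card ≤ d)
    (hcol : ∀ b, (Finset.univ.filter fun a => ¬ (R a b ↔ ka a < kb b)).card ≤ d)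
    (S : Fin (p * (8 * d + 1)) → Set (α ⊕ β)) (hS : ∀ i, ContainsTwoK₂ R (S i))
    (hlt : ∀ i j, i < j → ∀ u ∈ S i, ∀ v ∈ S j, Sum.elim ka kb u < Sum.elim ka kb v) :
    HasDoubleChain R p := by
  choose x y u v hx hy hu hv hxu hyv hxv hyu using hS
  have hinj : ∀ w : Fin (p * (8 * d + 1)) → α ⊕ β, (∀ k, w k ∈ S k) → Function.Injective w := by
    intro w hw k l hkl
    rcases lt_trichotomy k l with h | h | h
    · have := hlt k l h _ (hw k) _ (hw l)
      rw [hkl] at this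
      exact absurd this (lt_irrefl _)
    · exact h
    · have := hlt l k h _ (hw l) _ (hw k)
      rw [hkl] at this
      exact absurd this (lt_irrefl _)
  set H : α → β → Prop := fun a b => ¬ (R a b ↔ ka a < kb b) with hH
  have hr : ∀ (w : Fin (p * (8 * d + 1)) → β), Function.Injective w → ∀ a,
      (Finset.univ.filter fun j => H a (w j)).card ≤ d := by
    intro w hw a
    rw [← Finset.card_image_of_injective _ hw]
    refine (Finset.card_le_card ?_).trans (hrow a)
    intro b
    simp only [Finset.mem_image, Finset.mem_filter, Finset.mem_univ, true_and]
    rintro ⟨j, hj, rfl⟩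
    exact hj
  have hc : ∀ (w : Fin (p * (8 * d + 1)) → α), Function.Injective w → ∀ b,
      (Finset.univ.filter fun j => H (w j) b).card ≤ d := by
    intro w hw a
    rw [← Finset.card_image_of_injective _ hw]
    refine (Finset.card_le_card ?_).trans (hcol a)
    intro b
    simp only [Finset.mem_image, Finset.mem_filter, Finset.mem_univ, true_and]
    rintro ⟨j, hj, rfl⟩
    exact hj
  have hxi : Function.Injective x := (hinj (Sum.inl ∘ x) hx).of_comp
  have hyi : Function.Injective y := (hinj (Sum.inl ∘ y) hy).of_comp
  have hui : Function.Injective u := (hinj (Sum.inr ∘ u) hu).of_comp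
  have hvi : Function.Injective v := (hinj (Sum.inr ∘ v) hv).of_comp
  -- The constant `8 * d` counts four types of disagreement between two blocks, in two directions,
  -- at most `d` of each.
  obtain ⟨T, -, hTc, hT⟩ := exists_independent
    (fun i j => H (x i) (u j) ∨ H (x i) (v j) ∨ H (y i) (u j) ∨ H (y i) (v j)) (8 * d) p
    Finset.univ (fun i _ => by
      have h1 := hr u hui (x i)
      have h2 := hr v hvi (x i)
      have h3 := hr u hui (y i)
      have h4 := hr v hvi (y i)
      have h5 := hc x hxi (u i)
      have h6 := hc x hxi (v i)
      have h7 := hc y hyi (u i)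
      have h8 := hc y hyi (v i)
      simp only [Finset.filter_or]
      have hle : ∀ (A B : Finset (Fin (p * (8 * d + 1)))) (m n : ℕ), A.card ≤ m → B.card ≤ n →
        (A ∪ B).card ≤ m + n := fun A B m n hA hB =>
          (Finset.card_union_le _ _).trans (Nat.add_le_add hA hB)
      refine (hle _ _ _ _ (hle _ _ _ _ h1 (hle _ _ _ _ h2 (hle _ _ _ _ h3 h4)))
        (hle _ _ _ _ h5 (hle _ _ _ _ h6 (hle _ _ _ _ h7 h8)))).trans (by omega)) (by simp)
  let σ := T.orderEmbOfFin hTc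
  -- Between different chosen blocks `R` agrees with the key order, hence with the order of the
  -- blocks.
  have hcross : ∀ i j, i ≠ j → ∀ a b, Sum.inl a ∈ S (σ i) → Sum.inr b ∈ S (σ j) → ¬ H a b →
      (R a b ↔ i < j) := by
    intro i j hij a b ha hb hab
    rw [not_not.1 hab]
    rcases lt_or_gt_of_ne hij with h | h
    · exact iff_of_true (hlt _ _ (σ.lt_iff_lt.2 h) _ ha _ hb) h
    · exact iff_of_false (hlt _ _ (σ.lt_iff_lt.2 h) _ hb _ ha).not_gt h.not_gt
  have hnot : ∀ i j, i ≠ j → ¬ H (x (σ i)) (u (σ j)) ∧ ¬ H (x (σ i)) (v (σ j)) ∧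
      ¬ H (y (σ i)) (u (σ j)) ∧ ¬ H (y (σ i)) (v (σ j)) := by
    intro i j hij
    have := hT (σ i) (T.orderEmbOfFin_mem hTc i) (σ j) (T.orderEmbOfFin_mem hTc j)
      (fun h => hij (σ.injective h))
    tauto
  refine ⟨x ∘ σ, y ∘ σ, u ∘ σ, v ∘ σ, fun i j => ?_⟩
  rcases eq_or_ne i j with rfl | hij
  · simp [hxu, hyv, hxv, hyu]
  · obtain ⟨h1, h2, h3, h4⟩ := hnot i j hij
    have hle : i ≤ j ↔ i < j := ⟨fun h => lt_of_le_of_ne h hij, le_of_lt⟩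
    rw [hle]
    exact ⟨hcross i j hij _ _ (hx _) (hu _) h1, hcross i j hij _ _ (hy _) (hv _) h4,
      hcross i j hij _ _ (hx _) (hv _) h2, hcross i j hij _ _ (hy _) (hu _) h3⟩

open scoped Classical in
-- All these pairs are disagreements straddling the same cut `c`. In an induced matching of
-- disagreements among them, every mixed pair also straddles `c` from left to right and agrees with
-- the chain, so it is related: this is a co-matching.
theorem card_crossing_zeros_lt
    (hrow : ∀ a, (Finset.univ.filter fun b => ¬ (R a b ↔ ka a < kb b)).card ≤ d)
    (hcol : ∀ b, (Finset.univ.filter fun a => ¬ (R a b ↔ ka a < kb b)).card ≤ d)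
    (hC : ¬ HasCoMatching R p) (sa : α → ℕ) (sb : β → ℕ)
    (hs : ∀ a b, sa a < sb b → ka a < kb b) (c : ℕ) :
    (Finset.univ.filter fun q : α × β => sa q.1 ≤ c ∧ c < sb q.2 ∧ ¬ R q.1 q.2).card ≤
      p * (2 * d ^ 2 + 1) := by
  by_contra! hp
  obtain ⟨S, hS, hSp, hind⟩ := exists_induced_pairs (fun a b => ¬ (R a b ↔ ka a < kb b)) d p
    (fun a => by convert hrow a) (fun b => by convert hcol b)
    (Finset.univ.filter fun q : α × β => sa q.1 ≤ c ∧ c < sb q.2 ∧ ¬ R q.1 q.2)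
    (fun q hq => by
      simp only [Finset.mem_filter, Finset.mem_univ, true_and] at hq
      have := hs q.1 q.2 (by omega)
      tauto) hp.le
  refine hC (hasCoMatching_of_finset (S := S) (f := Prod.fst) (g := Prod.snd) ?_ hSp.ge)
  intro i hi j hj
  have h1 := hS hi
  have h2 := hS hj
  simp only [Finset.mem_filter, Finset.mem_univ, true_and] at h1 h2
  constructor
  · rintro h rfl
    exact h1.2.2 h
  · intro hij
    have := hs i.1 j.2 (by omega)
    have := hind i hi j hj hij
    tauto

open scoped Classical in
-- The mirror image: mixed pairs straddle `c` from right to left and are unrelated, which gives a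
-- matching.
theorem card_crossing_ones_lt
    (hrow : ∀ a, (Finset.univ.filter fun b => ¬ (R a b ↔ ka a < kb b)).card ≤ d)
    (hcol : ∀ b, (Finset.univ.filter fun a => ¬ (R a b ↔ ka a < kb b)).card ≤ d)
    (hM : ¬ HasMatching R p) (sa : α → ℕ) (sb : β → ℕ)
    (hs : ∀ a b, sb b < sa a → kb b < ka a) (c : ℕ) :
    (Finset.univ.filter fun q : α × β => sb q.2 ≤ c ∧ c < sa q.1 ∧ R q.1 q.2).card ≤
      p * (2 * d ^ 2 + 1) := by
  by_contra! hp
  obtain ⟨S, hS, hSp, hind⟩ := exists_induced_pairs (fun a b => ¬ (R a b ↔ ka a < kb b)) d p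
    (fun a => by convert hrow a) (fun b => by convert hcol b)
    (Finset.univ.filter fun q : α × β => sb q.2 ≤ c ∧ c < sa q.1 ∧ R q.1 q.2)
    (fun q hq => by
      simp only [Finset.mem_filter, Finset.mem_univ, true_and] at hq
      have := (hs q.1 q.2 (by omega)).not_gt
      tauto) hp.le
  refine hM (hasMatching_of_finset (S := S) (f := Prod.fst) (g := Prod.snd) ?_ hSp.ge)
  intro i hi j hj
  have h1 := hS hi
  have h2 := hS hj
  simp only [Finset.mem_filter, Finset.mem_univ, true_and] at h1 h2
  constructor
  · intro h
    by_contra hij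
    have := (hs i.1 j.2 (by omega)).not_gt
    have := hind i hi j hj hij
    tauto
  · rintro rfl
    exact h1.2.2

end Crossing

/-- The bound of `exists_chain_with_few_exceptions`. -/
def exceptionBound (p : ℕ) : ℕ :=
  2 * (p * (8 * (2 * p) + 1)) * (2 * (p * (2 * (2 * p) ^ 2 + 1)))

open scoped Classical in
/-- Without large matchings, complements of matchings and double chains, a quasi-chain relation
differs from a chain relation in boundedly many pairs. -/
theorem exists_chain_with_few_exceptions [Fintype α] [Fintype β] {R : α → β → Prop}
    (hR : IsQuasiChainRel R) {p : ℕ} (hM : ¬ HasMatching R p) (hC : ¬ HasCoMatching R p)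
    (hD : ¬ HasDoubleChain R p) :
    ∃ (ka : α → ℕ ×ₗ ℕ) (kb : β → ℕ ×ₗ ℕ), (∀ a b, ka a ≠ kb b) ∧
      (Finset.univ.filter fun q : α × β => ¬ (R q.1 q.2 ↔ ka q.1 < kb q.2)).card ≤
        exceptionBound p := by
  obtain ⟨ka, kb, hne, hrow, hcol⟩ := exists_chain_with_bounded_difference hR hM hC
  rcases exists_blocks_or_segments (Sum.elim ka kb) (ContainsTwoK₂ R)
    (fun S T hST ⟨x, y, u, v, hx, hy, hu, hv, h⟩ =>
      ⟨x, y, u, v, hST hx, hST hy, hST hu, hST hv, h⟩)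
    (fun t ⟨x, y, u, v, hx, hy, hu, hv, h⟩ => hne x u (hx.trans hu.symm))
    (p * (8 * (2 * p) + 1)) 0 with ⟨S, hS, -, hSk⟩ | ⟨seg, hseg, hsegm, hgood⟩
  · exact absurd (hasDoubleChain_of_blocks hrow hcol S hS hSk) hD
  set P := p * (8 * (2 * p) + 1)
  set sa : α → ℕ := fun a => seg (Sum.inl a) with hsa
  set sb : β → ℕ := fun b => seg (Sum.inr b) with hsb
  obtain ⟨ra, rb, hr⟩ := exists_chain_of_not_containsTwoK₂ R sa sb (fun c hc => by
    refine hgood c ?_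
    convert hc using 2
    ext v
    rcases v with v | v <;> simp [hsa, hsb])
  have h1 : ∀ a b, sa a < sb b → ka a < kb b := by
    intro a b h
    by_contra h'
    exact absurd h (not_lt.2 (hsegm (Sum.inr b) (Sum.inl a) (not_lt.1 h')))
  have h2 : ∀ a b, sb b < sa a → kb b < ka a := by
    intro a b h
    by_contra h'
    exact absurd h (not_lt.2 (hsegm (Sum.inl a) (Sum.inr b) (not_lt.1 h')))
  -- Segment first, rank within the segment second. The parities keep row and column keys apart, and
  -- `2 * ra a + 1 < 2 * rb b` still means `ra a < rb b`.
  refine ⟨fun a => toLex (sa a, 2 * ra a + 1), fun b => toLex (sb b, 2 * rb b), fun a b h => ?_, ?_⟩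
  · have := congrArg (fun z => (ofLex z).2) h
    simp only [ofLex_toLex] at this
    omega
  -- No exception lies inside a segment, so each straddles the cut at the smaller of its two segment
  -- numbers, one of `2 * P`.
  · have hsub : (Finset.univ.filter fun q : α × β => ¬ (R q.1 q.2 ↔
        (toLex (sa q.1, 2 * ra q.1 + 1) : ℕ ×ₗ ℕ) < toLex (sb q.2, 2 * rb q.2))) ⊆
        (Finset.range (2 * P)).biUnion fun c =>
          (Finset.univ.filter fun q : α × β => sa q.1 ≤ c ∧ c < sb q.2 ∧ ¬ R q.1 q.2) ∪
          (Finset.univ.filter fun q : α × β => sb q.2 ≤ c ∧ c < sa q.1 ∧ R q.1 q.2) := by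
      rintro ⟨a, b⟩ hq
      simp only [Finset.mem_filter, Finset.mem_univ, true_and, Prod.Lex.toLex_lt_toLex] at hq
      simp only [Finset.mem_biUnion, Finset.mem_range, Finset.mem_union, Finset.mem_filter,
        Finset.mem_univ, true_and]
      rcases lt_trichotomy (sa a) (sb b) with h | h | h
      · exact ⟨sa a, hseg _, Or.inl ⟨le_rfl, h, by tauto⟩⟩
      · have h3 : 2 * ra a + 1 < 2 * rb b ↔ ra a < rb b := by omega
        have := hr a b h
        have h4 : ¬ sa a < sb b := h.not_lt
        tauto
      · have h4 : ¬ sa a < sb b := h.not_gt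
        have h5 : ¬ sa a = sb b := h.ne'
        exact ⟨sb b, hseg _, Or.inr ⟨le_rfl, h, by tauto⟩⟩
    refine (Finset.card_le_card hsub).trans ((Finset.card_biUnion_le_card_mul _ _ _
      (fun c _ => ?_)).trans (Nat.mul_le_mul_right _ (Finset.card_range _).le))
    refine (Finset.card_union_le _ _).trans ((Nat.add_le_add
      (card_crossing_zeros_lt hrow hcol hC sa sb h1 c)
      (card_crossing_ones_lt hrow hcol hM sa sb h2 c)).trans (two_mul _).ge)

end Segmentation

/-! ### Constructing letter graphs, and lower bounds on lettericity. -/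

section Letters

variable {V : Type*}

/-- A letter graph may be given by a labelling over any finite alphabet and an ordering key that
separates distinct vertices unless they and their letters are not adjacent. -/
theorem isLetterGraph_of_key [Finite V] {L Ω : Type*} [LinearOrder L] [Fintype Ω]
    {G : SimpleGraph V} (f : V → L) (l : V → Ω) (P : Ω → Ω → Prop)
    (hlt : ∀ u v, f u < f v → (G.Adj u v ↔ P (l u) (l v)))
    (heq : ∀ u v, u ≠ v → f u = f v → ¬ G.Adj u v ∧ ¬ P (l u) (l v)) {k : ℕ}
    (hk : Fintype.card Ω ≤ k) :
    IsLetterGraph k G := by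
  have := Fintype.ofFinite V
  obtain ⟨e, he⟩ := exists_equiv_fin_of_key f
  let c : Ω → Fin k := fun ω => Fin.castLE hk (Fintype.equivFin Ω ω)
  have hc : Function.Injective c :=
    (Fin.castLE_injective hk).comp (Fintype.equivFin Ω).injective
  have hP : ∀ u v, e u < e v → (G.Adj u v ↔ P (l u) (l v)) := by
    intro u v huv
    have huv' : u ≠ v := fun h => huv.ne (congrArg e h)
    rcases lt_trichotomy (f u) (f v) with h | h | h
    · exact hlt u v h
    · exact iff_of_false (heq u v huv' h).1 (heq u v huv' h).2
    · exact absurd huv (he v u h).not_gt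
  have hD : ∀ ω ω', (c ω, c ω') ∈ {q | ∃ ω ω', q = (c ω, c ω') ∧ P ω ω'} ↔ P ω ω' := by
    intro ω ω'
    constructor
    · rintro ⟨a, b, hab, h⟩
      rw [Prod.mk.injEq] at hab
      rwa [hc hab.1, hc hab.2]
    · exact fun h => ⟨ω, ω', rfl, h⟩
  refine ⟨{q | ∃ ω ω', q = (c ω, c ω') ∧ P ω ω'}, _, fun i => c (l (e.symm i)), ⟨⟨e, ?_⟩⟩⟩
  intro u v
  change (e u < e v ∧ (c (l (e.symm (e u))), c (l (e.symm (e v)))) ∈ _) ∨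
    (e v < e u ∧ (c (l (e.symm (e v))), c (l (e.symm (e u)))) ∈ _) ↔ _
  simp only [Equiv.symm_apply_apply, hD]
  rcases lt_trichotomy (e u) (e v) with h | h | h
  · simp [h, h.not_gt, hP u v h]
  · have := e.injective h
    subst this
    simp
  · simp [h, h.not_gt, ← hP v u h, G.adj_comm]

/-- The positions and the letters of the vertices of a letter graph. -/
theorem IsLetterGraph.exists_word {G : SimpleGraph V} {k : ℕ} (h : IsLetterGraph k G) :
    ∃ (P : Fin k → Fin k → Prop) (f : V → ℕ) (l : V → Fin k), Function.Injective f ∧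
      ∀ u v, G.Adj u v ↔ (f u < f v ∧ P (l u) (l v)) ∨ (f v < f u ∧ P (l v) (l u)) := by
  obtain ⟨P, n, w, ⟨φ⟩⟩ := h
  refine ⟨fun a b => (a, b) ∈ P, fun v => (φ v : Fin n), fun v => w (φ v),
    fun u v huv => φ.injective (Fin.ext huv), fun u v => ?_⟩
  rw [← φ.map_adj_iff]
  rfl

theorem IsLetterGraph.mono [Finite V] {G : SimpleGraph V} {k l : ℕ} (h : IsLetterGraph k G)
    (hkl : k ≤ l) : IsLetterGraph l G := by
  obtain ⟨P, f, w, hf, hadj⟩ := h.exists_word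
  refine isLetterGraph_of_key f w P (fun u v huv => ?_)
    (fun u v huv h => absurd (hf h) huv) (by simpa using hkl)
  simp [hadj, huv, huv.not_gt]

theorem isLetterGraph_of_lettericity_le {G : FinGraph} {k : ℕ} (h : lettericity G ≤ k) :
    IsLetterGraph k G.graph := by
  have hne : {k | IsLetterGraph k G.graph}.Nonempty := ⟨_, isLetterGraph_card G.graph⟩
  exact IsLetterGraph.mono (Nat.sInf_mem hne) h

/-- A chain graph with few exceptions is a letter graph over a small alphabet. -/
theorem isLetterGraph_of_few_exceptions {α β L : Type*} [Fintype α] [Fintype β] [LinearOrder L]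
    (G : SimpleGraph (α ⊕ β)) (hα : ∀ a a', ¬ G.Adj (Sum.inl a) (Sum.inl a'))
    (hβ : ∀ b b', ¬ G.Adj (Sum.inr b) (Sum.inr b')) (ka : α → L) (kb : β → L)
    (hne : ∀ a b, ka a ≠ kb b) (E : Finset (α × β))
    (hE : ∀ a b, (a, b) ∉ E → (G.Adj (Sum.inl a) (Sum.inr b) ↔ ka a < kb b)) :
    IsLetterGraph (2 * E.card + 2) G := by
  classical
  let X := E.image Prod.fst
  let Y := E.image Prod.snd
  let R : α → β → Prop := fun a b => G.Adj (Sum.inl a) (Sum.inr b)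
  -- Vertices in an exceptional pair have private letters, and the rest of each side shares `none`.
  -- Between two private letters the decoder gives the true adjacency in either order; as soon as
  -- `none` occurs it follows the chain rule, "left letter before right letter".
  let P : Option X ⊕ Option Y → Option X ⊕ Option Y → Prop
    | Sum.inl (some a), Sum.inr (some b) => R a b
    | Sum.inl none, Sum.inr _ => True
    | Sum.inl _, Sum.inr none => True
    | Sum.inr (some b), Sum.inl (some a) => R a b
    | _, _ => False
  let la : α → Option X := fun a => if h : a ∈ X then some ⟨a, h⟩ else none
  let lb : β → Option Y := fun b => if h : b ∈ Y then some ⟨b, h⟩ else none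
  have h1 : ∀ a b, ka a < kb b → (R a b ↔ P (Sum.inl (la a)) (Sum.inr (lb b))) := by
    intro a b hab
    by_cases ha : a ∈ X
    · by_cases hb : b ∈ Y
      · simp [la, lb, ha, hb, P]
      · have : (a, b) ∉ E := fun h => hb (Finset.mem_image_of_mem Prod.snd h)
        simp [la, lb, ha, hb, P, R, hE a b this, hab]
    · have : (a, b) ∉ E := fun h => ha (Finset.mem_image_of_mem Prod.fst h)
      simp [la, ha, P, R, hE a b this, hab]
  have h2 : ∀ a b, kb b < ka a → (R a b ↔ P (Sum.inr (lb b)) (Sum.inl (la a))) := by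
    intro a b hab
    by_cases ha : a ∈ X
    · by_cases hb : b ∈ Y
      · simp [la, lb, ha, hb, P]
      · have : (a, b) ∉ E := fun h => hb (Finset.mem_image_of_mem Prod.snd h)
        simp [la, lb, ha, hb, P, R, hE a b this, hab.not_gt]
    · have : (a, b) ∉ E := fun h => ha (Finset.mem_image_of_mem Prod.fst h)
      simp [la, ha, P, R, hE a b this, hab.not_gt]
  refine isLetterGraph_of_key (Sum.elim ka kb) (Sum.map la lb) P ?_ ?_ ?_
  · rintro (a | b) (a' | b') h
    · exact iff_of_false (hα a a') (by simp [P])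
    · exact h1 a b' h
    · rw [G.adj_comm]
      exact h2 a' b h
    · exact iff_of_false (hβ b b') (by simp [P])
  · rintro (a | b) (a' | b') - h
    · exact ⟨hα a a', by simp [P]⟩
    · exact absurd h (hne a b')
    · exact absurd h.symm (hne a' b)
    · exact ⟨hβ b b', by simp [P]⟩
  · have hX : X.card ≤ E.card := Finset.card_image_le
    have hY : Y.card ≤ E.card := Finset.card_image_le
    simp
    omega

/-- If two families of vertices of a letter graph are long compared with the alphabet, then some two
cross pairs agree. -/
theorem IsLetterGraph.exists_adj_iff {G : SimpleGraph V} {k n : ℕ} (hG : IsLetterGraph k G)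
    (hn : k * k * 2 < n) (f g : Fin n → V) (hfg : ∀ i, f i ≠ g i) :
    ∃ i j, i ≠ j ∧ (G.Adj (f i) (g j) ↔ G.Adj (f i) (g i)) := by
  classical
  obtain ⟨P, φ, w, hφ, hadj⟩ := hG.exists_word
  -- The pigeonholes are two letters and the relative order of `f i` and `g i`, hence `k * k * 2`.
  obtain ⟨i, j, hij, h⟩ := Fintype.exists_ne_map_eq_of_card_lt
    (fun i : Fin n => ((w (f i), w (g i)), decide (φ (f i) < φ (g i))))
    (by simpa using hn)
  simp only [Prod.mk.injEq, decide_eq_decide] at h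
  obtain ⟨⟨hf, hg⟩, hlt⟩ := h
  have key : ∀ i j, w (f i) = w (f j) → w (g i) = w (g j) →
      ((φ (f i) < φ (g i) ∧ φ (f i) < φ (g j)) ∨ (φ (g i) < φ (f i) ∧ φ (g j) < φ (f i))) →
      (G.Adj (f i) (g j) ↔ G.Adj (f i) (g i)) := by
    intro i j hf hg h
    rcases h with ⟨h1, h2⟩ | ⟨h1, h2⟩ <;>
      simp [hadj, h1, h2, h1.not_gt, h2.not_gt, hg]
  have hnei : φ (f i) ≠ φ (g i) := fun h => hfg i (hφ h)
  have hnej : φ (f j) ≠ φ (g j) := fun h => hfg j (hφ h)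
  -- If the `f`'s precede their `g`'s, the earlier `f` precedes both `g`'s; otherwise the later `f`
  -- follows both. Equal letters then give it equal adjacency to both.
  by_cases h1 : φ (f i) < φ (g i)
  · have h2 := hlt.1 h1
    rcases le_total (φ (f i)) (φ (f j)) with h3 | h3
    · exact ⟨i, j, hij, key i j hf hg (Or.inl ⟨h1, h3.trans_lt h2⟩)⟩
    · exact ⟨j, i, hij.symm, key j i hf.symm hg.symm (Or.inl ⟨h2, h3.trans_lt h1⟩)⟩
  · have h2 := mt hlt.2 h1
    rcases le_total (φ (f i)) (φ (f j)) with h3 | h3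
    · exact ⟨j, i, hij.symm, key j i hf.symm hg.symm (Or.inr ⟨by omega, by omega⟩)⟩
    · exact ⟨i, j, hij, key i j hf hg (Or.inr ⟨by omega, by omega⟩)⟩

/-- Long double chains have large lettericity. -/
theorem not_isLetterGraph_of_hasDoubleChain {α β : Type*} {G : SimpleGraph V} {f : α → V}
    {g : β → V} (hfg : ∀ a b, f a ≠ g b) {k n : ℕ} (hn : k ^ 4 < n)
    (h : HasDoubleChain (fun a b => G.Adj (f a) (g b)) n) : ¬ IsLetterGraph k G := by
  intro hG
  obtain ⟨P, φ, w, hφ, hadj⟩ := hG.exists_word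
  obtain ⟨x, y, u, v, h⟩ := h
  obtain ⟨i, j, hij, hw⟩ : ∃ i j : Fin n, i < j ∧
      (w (f (x i)), w (f (y i)), w (g (u i)), w (g (v i))) =
        (w (f (x j)), w (f (y j)), w (g (u j)), w (g (v j))) := by
    obtain ⟨i, j, hij, h⟩ := Fintype.exists_ne_map_eq_of_card_lt
      (fun i : Fin n => (w (f (x i)), w (f (y i)), w (g (u i)), w (g (v i))))
      (by simp; linarith [show k * (k * (k * k)) = k ^ 4 by ring])
    rcases lt_or_gt_of_ne hij with h1 | h1
    · exact ⟨i, j, h1, h⟩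
    · exact ⟨j, i, h1, h.symm⟩
  simp only [Prod.mk.injEq] at hw
  obtain ⟨hx, hy, hu, hv⟩ := hw
  -- Here `a`, `b` are the positions of an `f`- and a `g`-vertex in block `i`, `a'`, `b'` those in
  -- block `j`, and `e` is their adjacency within a block. Since only the cross pair from `i` to `j`
  -- is adjacent, exactly one of `p` and `q` holds, which fixes the order of all four positions up
  -- to reversal.
  have pair : ∀ (e p q : Prop) (a b a' b' : ℕ), a' ≠ b →
      (((a < b ∧ p) ∨ (b < a ∧ q)) ↔ e) → (((a' < b' ∧ p) ∨ (b' < a' ∧ q)) ↔ e) →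
      ((a < b' ∧ p) ∨ (b' < a ∧ q)) → ¬ ((a' < b ∧ p) ∨ (b < a' ∧ q)) →
      (a < b' ∧ b < a' ∧ (e → a < b ∧ a' < b') ∧ (¬ e → b ≤ a ∧ b' ≤ a')) ∨
      (b' < a ∧ a' < b ∧ (e → b < a ∧ b' < a') ∧ (¬ e → a ≤ b ∧ a' ≤ b')) := by
    clear * -
    intro e p q a b a' b' hne h1 h2 h3 h4
    by_cases he : e <;> by_cases hp : p <;> by_cases hq : q <;>
      simp only [he, hp, hq, and_true, and_false, or_false, false_or, iff_true, iff_false,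
        not_true_eq_false, not_false_eq_true, true_imp_iff, false_imp_iff, true_and] at * <;>
      omega
  obtain ⟨a1, a2, a3, a4⟩ := h i i
  obtain ⟨b1, b2, b3, b4⟩ := h j j
  obtain ⟨c1, c2, c3, c4⟩ := h i j
  obtain ⟨d1, d2, d3, d4⟩ := h j i
  simp only [hadj, hx, hy, hu, hv, le_refl, lt_irrefl, iff_true, hij, hij.le,
    hij.not_ge, hij.not_gt] at a1 a2 a3 a4 b1 b2 b3 b4 c1 c2 c3 c4 d1 d2 d3 d4
  have e1 := pair True _ _ _ _ _ _ (fun h => hfg _ _ (hφ h)) (iff_true_intro a1)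
    (iff_true_intro b1) c1 (by simpa using d1)
  have e2 := pair True _ _ _ _ _ _ (fun h => hfg _ _ (hφ h)) (iff_true_intro a2)
    (iff_true_intro b2) c2 (by simpa using d2)
  have e3 := pair False _ _ _ _ _ _ (fun h => hfg _ _ (hφ h)) a3 b3 c3 (by simpa using d3)
  have e4 := pair False _ _ _ _ _ _ (fun h => hfg _ _ (hφ h)) a4 b4 c4 (by simpa using d4)
  simp only [true_imp_iff, not_true_eq_false, false_imp_iff, not_false_eq_true, and_true,
    true_and] at e1 e2 e3 e4
  clear a1 a2 a3 a4 b1 b2 b3 b4 c1 c2 c3 c4 d1 d2 d3 d4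
  -- All four pairs must have the same orientation. In the forward one, with vertices standing for
  -- positions, x_i < u_i ≤ y_i < v_i ≤ x_i; the reversed one has the cycle x_j ≤ v_j < y_j ≤ u_j <
  -- x_j.
  omega

end Letters

/-! ### Passing between bipartite graphs and relations. -/

section BipartiteGraphs

/-- The bipartite graph of a relation. -/
def relGraph {α β : Type*} (R : α → β → Prop) : SimpleGraph (α ⊕ β) where
  Adj
    | Sum.inl a, Sum.inr b => R a b
    | Sum.inr b, Sum.inl a => R a b
    | _, _ => False
  symm := ⟨by rintro (i | i) (j | j) h <;> exact h⟩
  loopless := ⟨by rintro (i | i) h <;> exact h⟩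

section relGraph

variable {α β : Type*} {R : α → β → Prop}

@[simp] theorem relGraph_inl_inr {a : α} {b : β} :
    (relGraph R).Adj (Sum.inl a) (Sum.inr b) ↔ R a b := Iff.rfl

@[simp] theorem relGraph_inr_inl {a : α} {b : β} :
    (relGraph R).Adj (Sum.inr b) (Sum.inl a) ↔ R a b := Iff.rfl

@[simp] theorem not_relGraph_inl_inl {a a' : α} :
    ¬ (relGraph R).Adj (Sum.inl a) (Sum.inl a') := id

@[simp] theorem not_relGraph_inr_inr {b b' : β} :
    ¬ (relGraph R).Adj (Sum.inr b) (Sum.inr b') := id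

theorem isBipartition_relGraph :
    IsBipartition (relGraph R) (Set.range Sum.inl) (Set.range Sum.inr) := by
  refine ⟨⟨?_, ?_⟩, Set.range_inl_union_range_inr⟩
  · rw [Set.disjoint_left]
    rintro _ ⟨a, rfl⟩ ⟨b, h⟩
    simp at h
  · rintro (a | b) (a' | b') h <;> simp_all

/-- Quasi-chain relations without large obstructions have letter graphs over small alphabets. -/
theorem isLetterGraph_relGraph [Finite α] [Finite β] (hR : IsQuasiChainRel R) {p : ℕ}
    (hM : ¬ HasMatching R p) (hC : ¬ HasCoMatching R p) (hD : ¬ HasDoubleChain R p) :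
    IsLetterGraph (2 * exceptionBound p + 2) (relGraph R) := by
  classical
  have := Fintype.ofFinite α
  have := Fintype.ofFinite β
  obtain ⟨ka, kb, hne, hE⟩ := exists_chain_with_few_exceptions hR hM hC hD
  refine (isLetterGraph_of_few_exceptions (relGraph R) (fun _ _ => id) (fun _ _ => id) ka kb hne
    (Finset.univ.filter fun q : α × β => ¬ (R q.1 q.2 ↔ ka q.1 < kb q.2))
    (fun a b hab => by simpa using hab)).mono ?_
  have h : (Finset.univ.filter fun q : α × β => ¬ (R q.1 q.2 ↔ ka q.1 < kb q.2)).card ≤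
    exceptionBound p := by convert hE
  omega

end relGraph

section Bipartition

variable {V : Type*} {G : SimpleGraph V} {A B : Set V}

theorem IsBipartition.symm (h : IsBipartition G A B) : IsBipartition G B A :=
  ⟨h.1.symm, by rw [Set.union_comm, h.2]⟩

theorem IsBipartition.mem_or_mem (h : IsBipartition G A B) (v : V) : v ∈ A ∨ v ∈ B := by
  rw [← Set.mem_union, h.2]
  trivial

theorem IsBipartition.notMem_right (h : IsBipartition G A B) {v : V} (hv : v ∈ A) : v ∉ B :=
  fun hv' => Set.disjoint_left.1 h.1.disjoint hv hv'

theorem IsBipartition.mem_right (h : IsBipartition G A B) {u v : V} (hu : u ∈ A)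
    (huv : G.Adj u v) : v ∈ B := by
  rcases h.1.mem_of_adj huv with h' | h'
  · exact h'.2
  · exact absurd h'.1 (h.notMem_right hu)

theorem IsBipartition.eq_compl (h : IsBipartition G A B) : B = Aᶜ := by
  ext v
  constructor
  · exact fun hv hv' => h.notMem_right hv' hv
  · exact fun hv => (h.mem_or_mem v).resolve_left hv

theorem IsBipartition.preimage {W : Type*} {H : SimpleGraph W} (h : IsBipartition G A B)
    (f : H →g G) : IsBipartition H (f ⁻¹' A) (f ⁻¹' B) := by
  refine ⟨⟨h.1.disjoint.preimage f, fun u v huv => h.1.mem_of_adj (f.map_adj huv)⟩, ?_⟩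
  rw [← Set.preimage_union, h.2, Set.preimage_univ]

/-- The relation between the two parts of a bipartition. -/
abbrev crossRel (G : SimpleGraph V) (A B : Set V) : A → B → Prop := fun a b => G.Adj a b

/-- A bipartite graph is the graph of the relation between its parts. -/
theorem IsBipartition.nonempty_iso (h : IsBipartition G A B) :
    Nonempty (relGraph (crossRel G A B) ≃g G) := by
  classical
  have hB := h.eq_compl
  subst hB
  refine ⟨⟨Equiv.Set.sumCompl A, ?_⟩⟩
  rintro (⟨a, ha⟩ | ⟨b, hb⟩) (⟨a', ha'⟩ | ⟨b', hb'⟩)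
  · exact iff_of_false (fun hadj => h.mem_right ha hadj ha') id
  · simp
  · exact G.adj_comm b a'
  · exact iff_of_false (fun hadj => hb' (h.symm.mem_right hb hadj)) id

theorem IsGoodOrdering.almostNested [Finite V] {l : List V} (hl : IsGoodOrdering G A l) (C : Set V)
    (x y : A) : AlmostNested (crossRel G A C) x y ∨ AlmostNested (crossRel G A C) y x := by
  let S : V → V → Prop := fun x y => (G.neighborSet y \ G.neighborSet x).ncard ≤ 1
  have key : ∀ x y : A, S x y → AlmostNested (crossRel G A C) x y := by
    intro x y h b b' hb hxb hb' hxb'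
    exact Subtype.ext ((Set.ncard_le_one).1 h b ⟨hb, hxb⟩ b' ⟨hb', hxb'⟩)
  rcases eq_or_ne x y with rfl | hxy
  · exact Or.inl fun b b' hb hxb => absurd hb hxb
  · have : Std.Symm (fun x y => S x y ∨ S y x) := ⟨fun _ _ => Or.symm⟩
    have hp : l.Pairwise (fun x y => S x y ∨ S y x) := hl.2.2.imp Or.inl
    exact (hp.forall ((hl.2.1 x).2 x.2) ((hl.2.1 y).2 y.2)
      (fun h => hxy (Subtype.ext h))).imp (key x y) (key y x)

theorem isQuasiChainRel_crossRel [Finite V] (hA : ∃ l, IsGoodOrdering G A l)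
    (hB : ∃ l, IsGoodOrdering G B l) : IsQuasiChainRel (crossRel G A B) := by
  obtain ⟨l, hl⟩ := hA
  obtain ⟨m, hm⟩ := hB
  refine ⟨hl.almostNested B, fun x y => ?_⟩
  have hflip : flip (crossRel G A B) = crossRel G B A := by
    funext b a
    exact propext (G.adj_comm _ _)
  rw [hflip]
  exact hm.almostNested A x y

/-- A key along which neighbourhoods are almost decreasing provides a good ordering. -/
theorem exists_isGoodOrdering_of_key [Finite V] (f : V → ℤ)
    (hf : ∀ x ∈ A, ∀ y ∈ A, x ≠ y → f x ≤ f y → ∀ b b', G.Adj y b → ¬ G.Adj x b → G.Adj y b' →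
      ¬ G.Adj x b' → b = b') : ∃ l, IsGoodOrdering G A l := by
  classical
  have := Fintype.ofFinite V
  let r : V → V → Prop := fun x y => f x ≤ f y
  have : Std.Total r := ⟨fun x y => le_total _ _⟩
  have : IsTrans V r := ⟨fun x y z => le_trans⟩
  let l₀ := (Finset.univ.filter (· ∈ A)).toList
  have hnd : (List.insertionSort r l₀).Nodup :=
    (List.perm_insertionSort r l₀).nodup_iff.2 (Finset.nodup_toList _)
  have hmem : ∀ v, v ∈ List.insertionSort r l₀ ↔ v ∈ A := by
    intro v
    rw [(List.perm_insertionSort r l₀).mem_iff]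
    simp [l₀]
  refine ⟨List.insertionSort r l₀, hnd, hmem, ?_⟩
  refine ((List.pairwise_insertionSort r l₀).and hnd).imp_of_mem ?_
  rintro x y hx hy ⟨hxy, hne⟩
  rw [Set.ncard_le_one]
  rintro b ⟨hb, hxb⟩ b' ⟨hb', hxb'⟩
  exact hf x ((hmem x).1 hx) y ((hmem y).1 hy) hne hxy b b' hb hxb hb' hxb'

/-- Embedding a bipartite graph into the graph of a relation by embedding its parts. -/
theorem IsBipartition.isIndContained_relGraph (h : IsBipartition G A B) {α β : Type*}
    {R : α → β → Prop} (f : V → α) (g : V → β) (hf : Set.InjOn f A) (hg : Set.InjOn g B)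
    (hR : ∀ a ∈ A, ∀ b ∈ B, G.Adj a b ↔ R (f a) (g b)) : G.IsIndContained (relGraph R) := by
  classical
  let φ : V → α ⊕ β := fun v => if v ∈ A then Sum.inl (f v) else Sum.inr (g v)
  have hA : ∀ v ∈ A, φ v = Sum.inl (f v) := fun v hv => if_pos hv
  have hB : ∀ v ∈ B, φ v = Sum.inr (g v) := fun v hv => if_neg (h.symm.notMem_right hv)
  refine ⟨⟨⟨φ, fun u v huv => ?_⟩, ?_⟩⟩
  · rcases h.mem_or_mem u with hu | hu <;> rcases h.mem_or_mem v with hv | hv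
    · rw [hA u hu, hA v hv] at huv
      exact hf hu hv (Sum.inl_injective huv)
    · rw [hA u hu, hB v hv] at huv
      simp at huv
    · rw [hB u hu, hA v hv] at huv
      simp at huv
    · rw [hB u hu, hB v hv] at huv
      exact hg hu hv (Sum.inr_injective huv)
  · intro u v
    change (relGraph R).Adj (φ u) (φ v) ↔ G.Adj u v
    rcases h.mem_or_mem u with hu | hu <;> rcases h.mem_or_mem v with hv | hv
    · rw [hA u hu, hA v hv]
      exact iff_of_false id fun hadj => h.notMem_right hv (h.mem_right hu hadj)
    · rw [hA u hu, hB v hv, hR u hu v hv, relGraph_inl_inr]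
    · rw [hB u hu, hA v hv, G.adj_comm, hR v hv u hu, relGraph_inr_inl]
    · rw [hB u hu, hB v hv]
      exact iff_of_false id fun hadj => h.symm.notMem_right hv (h.symm.mem_right hu hadj)

end Bipartition

/-! ### Graphs of degree at most one and their bipartite complements. -/

section DegreeOne

variable {V : Type*} {G : SimpleGraph V} {A B : Set V}

/-- The neighbours of a vertex in a graph of maximum degree one are equal. -/
theorem ncard_neighborSet_le_one_iff [Finite V] :
    (∀ v, (G.neighborSet v).ncard ≤ 1) ↔ ∀ v a b, G.Adj v a → G.Adj v b → a = b := by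
  simp only [Set.ncard_le_one (Set.toFinite _), SimpleGraph.mem_neighborSet]
  exact ⟨fun h v a b ha hb => h v a ha b hb, fun h v a ha b hb => h v a b ha hb⟩

/-- In any enumeration, the earlier end of each edge and all isolated vertices form one part. -/
theorem exists_isBipartition_of_degree_le_one [Finite V]
    (hG : ∀ v a b, G.Adj v a → G.Adj v b → a = b) : ∃ A B, IsBipartition G A B := by
  let e := Finite.equivFin V
  have key : ∀ u v, G.Adj u v → e u < e v →
      (∀ w, G.Adj u w → e u < e w) ∧ ¬ ∀ w, G.Adj v w → e v < e w :=
    fun u v huv hlt => ⟨fun w hw => hG u v w huv hw ▸ hlt, fun h => (h u huv.symm).not_gt hlt⟩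
  refine ⟨{v | ∀ w, G.Adj v w → e v < e w}, {v | ∀ w, G.Adj v w → e v < e w}ᶜ,
    ⟨disjoint_compl_right, fun u v huv => ?_⟩, Set.union_compl_self _⟩
  rcases lt_or_gt_of_ne (fun h => huv.ne (e.injective h)) with h | h
  · exact Or.inl (key u v huv h)
  · exact Or.inr (key v u huv.symm h).symm

/-- In a bipartite graph of maximum degree one, the vertices of both parts can be indexed such that
the edges are the pairs of equal indices. -/
theorem IsBipartition.exists_index [Finite V] (h : IsBipartition G A B)
    (hG : ∀ v a b, G.Adj v a → G.Adj v b → a = b) :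
    ∃ idx : V → Fin (Nat.card V), Set.InjOn idx A ∧ Set.InjOn idx B ∧
      ∀ a ∈ A, ∀ b ∈ B, G.Adj a b ↔ idx a = idx b := by
  classical
  let e := Finite.equivFin V
  -- The index of a vertex of `A` is its own number; a vertex of `B` takes that of its partner, or
  -- its own if it is isolated.
  have hex : ∀ v, ∃ w, (v ∈ A → w = v) ∧ (v ∈ B → (∀ u, G.Adj v u → w = u) ∧
      (w = v ∨ G.Adj v w)) := by
    intro v
    rcases h.mem_or_mem v with hv | hv
    · exact ⟨v, fun _ => rfl, fun hv' => absurd hv' (h.notMem_right hv)⟩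
    · by_cases hadj : ∃ u, G.Adj v u
      · obtain ⟨u, hu⟩ := hadj
        exact ⟨u, fun hv' => absurd hv (h.notMem_right hv'),
          fun _ => ⟨fun u' hu' => hG v u u' hu hu', Or.inr hu⟩⟩
      · exact ⟨v, fun _ => rfl, fun _ => ⟨fun u hu => absurd ⟨u, hu⟩ hadj, Or.inl rfl⟩⟩
  choose w hwA hwB using hex
  refine ⟨e ∘ w, ?_, ?_, ?_⟩
  · intro a ha a' ha' heq
    have := e.injective heq
    rwa [hwA a ha, hwA a' ha'] at this
  · intro b hb b' hb' heq
    have heq : w b = w b' := e.injective heq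
    rcases (hwB b hb).2 with h1 | h1 <;> rcases (hwB b' hb').2 with h2 | h2
    · rw [← h1, ← h2, heq]
    · have := h.symm.mem_right hb' h2
      rw [← heq, h1] at this
      exact absurd hb (h.notMem_right this)
    · have := h.symm.mem_right hb h1
      rw [heq, h2] at this
      exact absurd hb' (h.notMem_right this)
    · rw [heq] at h1
      exact hG (w b') b b' h1.symm h2.symm
  · intro a ha b hb
    simp only [Function.comp_apply, hwA a ha, e.injective.eq_iff]
    constructor
    · exact fun hadj => ((hwB b hb).1 a hadj.symm).symm
    · rintro rfl
      rcases (hwB b hb).2 with h1 | h1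
      · rw [h1] at ha
        exact absurd hb (h.notMem_right ha)
      · exact h1.symm

theorem IsBipartition.isIndContained_of_hasMatching [Finite V] (h : IsBipartition G A B)
    (hG : ∀ v a b, G.Adj v a → G.Adj v b → a = b) {α β : Type*} {R : α → β → Prop}
    (hR : HasMatching R (Nat.card V)) : G.IsIndContained (relGraph R) := by
  obtain ⟨idx, hA, hB, hidx⟩ := h.exists_index hG
  obtain ⟨f, g, hfg⟩ := hR
  have hf : Function.Injective f := fun i j hij => by rw [← hfg, hij, hfg]
  have hg : Function.Injective g := fun i j hij => by rw [← hfg, ← hij, hfg]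
  refine h.isIndContained_relGraph (f ∘ idx) (g ∘ idx) (hf.comp_injOn hA) (hg.comp_injOn hB) ?_
  intro a ha b hb
  rw [hidx a ha b hb, Function.comp_apply, Function.comp_apply, hfg]

end DegreeOne

section BipartiteComplement

variable {V : Type*} {G : SimpleGraph V} {A B : Set V}

theorem isBipartition_bipartiteComplement (h : IsBipartition G A B) :
    IsBipartition (bipartiteComplement G A B) A B :=
  ⟨SimpleGraph.between_isBipartiteWith h.1.disjoint, h.2⟩

theorem bipartiteComplement_comm : bipartiteComplement G A B = bipartiteComplement G B A :=
  SimpleGraph.between_comm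

theorem bipartiteComplement_adj (h : IsBipartition G A B) {a b : V} (ha : a ∈ A) (hb : b ∈ B) :
    (bipartiteComplement G A B).Adj a b ↔ ¬ G.Adj a b := by
  have hne : a ≠ b := fun hab => h.notMem_right ha (hab ▸ hb)
  simp [bipartiteComplement, SimpleGraph.between_adj, ha, hb, hne]

theorem IsBipartition.isIndContained_of_hasCoMatching [Finite V] (h : IsBipartition G A B)
    (hG : ∀ v a b, G.Adj v a → G.Adj v b → a = b) {α β : Type*} {R : α → β → Prop}
    (hR : HasCoMatching R (Nat.card V)) :
    (bipartiteComplement G A B).IsIndContained (relGraph R) := by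
  obtain ⟨idx, hA, hB, hidx⟩ := h.exists_index hG
  obtain ⟨f, g, hfg⟩ := hR
  have hf : Function.Injective f := fun i j hij => not_not.1 fun hne => by
    have := (hfg i j).2 hne
    rw [hij, hfg] at this
    exact this rfl
  have hg : Function.Injective g := fun i j hij => not_not.1 fun hne => by
    have := (hfg i j).2 hne
    rw [← hij, hfg] at this
    exact this rfl
  refine (isBipartition_bipartiteComplement h).isIndContained_relGraph (f ∘ idx) (g ∘ idx)
    (hf.comp_injOn hA) (hg.comp_injOn hB) ?_
  intro a ha b hb
  rw [bipartiteComplement_adj h ha hb, hidx a ha b hb, Function.comp_apply, Function.comp_apply,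
    hfg]

theorem relGraph_ne_eq_bipartiteComplement {ι : Type*} :
    relGraph (fun i j : ι => i ≠ j) =
      bipartiteComplement (relGraph (fun i j : ι => i = j)) (Set.range Sum.inl)
        (Set.range Sum.inr) := by
  ext u v
  rcases u with i | i <;> rcases v with j | j <;>
    simp [bipartiteComplement, SimpleGraph.between_adj, eq_comm]

theorem relGraph_eq_degree_le_one {ι : Type*} (v a b : ι ⊕ ι)
    (ha : (relGraph (fun i j : ι => i = j)).Adj v a)
    (hb : (relGraph (fun i j : ι => i = j)).Adj v b) : a = b := by
  rcases v with i | i <;> rcases a with j | j <;> rcases b with k | k <;> simp_all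

end BipartiteComplement

/-! ### The graphs `D_n` as double chains. -/

section DoubleChain

/-- The indices of the vertices on either side of `D_n`. -/
abbrev DoubleChainIndex (n : ℕ) : Type := {i : Fin (3 * n) // ¬ 3 ∣ (i : ℕ) + 1}

variable {n : ℕ}

/-- The vertices of `D_n` on the left. -/
def leftVertex (i : DoubleChainIndex n) :
    {v : Fin (3 * n) ⊕ Fin (3 * n) | ¬ 3 ∣ chainIndex v} := ⟨Sum.inl i.1, i.2⟩

/-- The vertices of `D_n` on the right. -/
def rightVertex (i : DoubleChainIndex n) :
    {v : Fin (3 * n) ⊕ Fin (3 * n) | ¬ 3 ∣ chainIndex v} := ⟨Sum.inr i.1, i.2⟩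

/-- The adjacency relation between the two sides of `D_n`. -/
def doubleChainRel (n : ℕ) (i j : DoubleChainIndex n) : Prop :=
  (i.1 : ℕ) ≤ j.1 ∧ (j.1 : ℕ) ≠ i.1 + 1

theorem doubleChainGraph_adj (i j : DoubleChainIndex n) :
    (doubleChainGraph n).Adj (leftVertex i) (rightVertex j) ↔ doubleChainRel n i j := by
  have h : (doubleChainGraph n).Adj (leftVertex i) (rightVertex j) ↔
      i.1 ≤ j.1 ∧ ¬ ∃ i' j' : Fin (3 * n), (j' : ℕ) = i' + 1 ∧
        s(Sum.inl i.1, Sum.inr j.1) = s(Sum.inl i', Sum.inr j') :=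
    SimpleGraph.deleteEdges_adj
  rw [h, doubleChainRel, Fin.le_def]
  refine and_congr_right fun _ => not_congr ⟨?_, fun h => ⟨i.1, j.1, h, rfl⟩⟩
  rintro ⟨i', j', h1, h2⟩
  simp only [Sym2.eq_iff, Sum.inl.injEq, Sum.inr.injEq, reduceCtorEq, and_false, or_false] at h2
  rw [h2.1, h2.2, h1]

/-- `D_n` is the bipartite graph of `doubleChainRel n`. -/
def doubleChainIso (n : ℕ) : relGraph (doubleChainRel n) ≃g doubleChainGraph n where
  toFun := Sum.elim leftVertex rightVertex
  invFun
    | ⟨Sum.inl i, h⟩ => Sum.inl ⟨i, h⟩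
    | ⟨Sum.inr i, h⟩ => Sum.inr ⟨i, h⟩
  left_inv := by rintro (i | i) <;> rfl
  right_inv := by rintro ⟨i | i, h⟩ <;> rfl
  map_rel_iff' := by
    rintro (i | i) (j | j)
    · exact iff_of_false (fun h => SimpleGraph.deleteEdges_le _ h) id
    · exact doubleChainGraph_adj i j
    · exact (SimpleGraph.adj_comm _ _ _).trans (doubleChainGraph_adj j i)
    · exact iff_of_false (fun h => SimpleGraph.deleteEdges_le _ h) id

theorem hasDoubleChain_doubleChainRel (n : ℕ) : HasDoubleChain (doubleChainRel n) n := by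
  -- Counting from 0, the surviving indices are those congruent to 0 or 1 modulo 3, and block `i`
  -- consists of `3 * i` and `3 * i + 1` on both sides.
  let x : Fin n → DoubleChainIndex n := fun i => ⟨⟨3 * i, by omega⟩, by simp; omega⟩
  let y : Fin n → DoubleChainIndex n := fun i => ⟨⟨3 * i + 1, by omega⟩, by simp; omega⟩
  refine ⟨x, y, x, y, fun i j => ?_⟩
  simp only [doubleChainRel, x, y, Fin.le_def, Fin.lt_def]
  omega

/-- Two families distributed over the index set of `D_n`. -/
def interleave {γ : Type*} (s t : Fin n → γ) (i : DoubleChainIndex n) : γ :=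
  if (i.1 : ℕ) % 3 = 0 then s ⟨i.1 / 3, by omega⟩ else t ⟨i.1 / 3, by omega⟩

theorem interleave_injective {γ : Type*} {s t : Fin n → γ} (hs : Function.Injective s)
    (ht : Function.Injective t) (hst : ∀ i j, s i ≠ t j) :
    Function.Injective (interleave s t) := by
  rintro ⟨i, hi⟩ ⟨j, hj⟩ hij
  unfold interleave at hij
  split_ifs at hij with h1 h2 h2
  · have := congrArg Fin.val (hs hij)
    exact Subtype.ext (Fin.ext (by simp at *; omega))
  · exact absurd hij (hst _ _)
  · exact absurd hij.symm (hst _ _)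
  · have := congrArg Fin.val (ht hij)
    exact Subtype.ext (Fin.ext (by simp at *; omega))

/-- The pattern already describes all of `D_n`; it also forces the chosen vertices to be distinct.
-/
theorem isIndContained_of_hasDoubleChain {α β : Type*} {R : α → β → Prop}
    (hR : HasDoubleChain R n) : (relGraph (doubleChainRel n)).IsIndContained (relGraph R) := by
  obtain ⟨x, y, u, v, h⟩ := hR
  have hx : Function.Injective x := fun i j hij =>
    le_antisymm ((h i j).1.1 (hij ▸ (h j j).1.2 le_rfl)) ((h j i).1.1 (hij ▸ (h i i).1.2 le_rfl))
  have hy : Function.Injective y := fun i j hij => le_antisymm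
    ((h i j).2.1.1 (hij ▸ (h j j).2.1.2 le_rfl)) ((h j i).2.1.1 (hij ▸ (h i i).2.1.2 le_rfl))
  have hu : Function.Injective u := fun i j hij =>
    le_antisymm ((h i j).1.1 (hij ▸ (h i i).1.2 le_rfl)) ((h j i).1.1 (hij ▸ (h j j).1.2 le_rfl))
  have hv : Function.Injective v := fun i j hij => le_antisymm
    ((h i j).2.1.1 (hij ▸ (h i i).2.1.2 le_rfl)) ((h j i).2.1.1 (hij ▸ (h j j).2.1.2 le_rfl))
  have hxy : ∀ i j, x i ≠ y j := by
    intro i j hij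
    have h1 := (h j i).2.2.2.1 (hij ▸ (h i i).1.2 le_rfl)
    have h2 := (h i j).2.2.1.1 (hij ▸ (h j j).2.1.2 le_rfl)
    exact lt_asymm h1 h2
  have huv : ∀ i j, u i ≠ v j := by
    intro i j hij
    have h1 := (h i j).2.2.1.1 (hij ▸ (h i i).1.2 le_rfl)
    have h2 := (h j i).2.2.2.1 (hij ▸ (h j j).2.1.2 le_rfl)
    exact lt_asymm h1 h2
  refine isBipartition_relGraph.isIndContained_relGraph
    (Sum.elim (interleave x y) (interleave x y))
    (Sum.elim (interleave u v) (interleave u v)) ?_ ?_ ?_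
  · rintro _ ⟨i, rfl⟩ _ ⟨j, rfl⟩ hij
    exact congrArg _ (interleave_injective hx hy hxy hij)
  · rintro _ ⟨i, rfl⟩ _ ⟨j, rfl⟩ hij
    exact congrArg _ (interleave_injective hu hv huv hij)
  · rintro _ ⟨⟨i, hi⟩, rfl⟩ _ ⟨⟨j, hj⟩, rfl⟩
    simp only [relGraph_inl_inr, Sum.elim_inl, Sum.elim_inr, interleave, doubleChainRel]
    split_ifs with h1 h2 h2
    · rw [(h _ _).1, Fin.le_def]
      dsimp only
      omega
    · rw [(h _ _).2.2.1, Fin.lt_def]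
      dsimp only
      omega
    · rw [(h _ _).2.2.2, Fin.lt_def]
      dsimp only
      omega
    · rw [(h _ _).2.1, Fin.le_def]
      dsimp only
      omega

end DoubleChain

end BipartiteGraphs

/-! ### The three classes, and the criterion for bounded lettericity. -/

section Classes

theorem mem_inducedMatchings_iff {G : FinGraph} :
    G ∈ inducedMatchings ↔ ∀ v a b, G.graph.Adj v a → G.graph.Adj v b → a = b :=
  ncard_neighborSet_le_one_iff

theorem isHereditary_inducedMatchings : IsHereditary inducedMatchings := by
  rintro G hG H ⟨φ⟩
  rw [mem_inducedMatchings_iff] at hG ⊢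
  exact fun v a b ha hb =>
    φ.injective (hG _ _ _ (φ.map_adj_iff.2 ha) (φ.map_adj_iff.2 hb))

theorem isHereditary_coMatchings : IsHereditary coMatchings := by
  rintro ⟨V, _, G⟩ ⟨M, A, B, hM, hAB, hG⟩ ⟨W, _, H⟩ ⟨φ⟩
  refine ⟨M.comap φ, φ ⁻¹' A, φ ⁻¹' B, ?_, hAB.preimage (SimpleGraph.Hom.comap φ M), ?_⟩
  · rw [ncard_neighborSet_le_one_iff] at hM ⊢
    exact fun v a b ha hb => φ.injective (hM _ _ _ ha hb)
  · ext u v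
    change H.Adj u v ↔ _
    rw [← φ.map_adj_iff, iff_of_eq (congrArg (fun K => K.Adj (φ u) (φ v)) hG)]
    simp [bipartiteComplement, SimpleGraph.between_adj, φ.injective.ne_iff]

theorem isHereditary_doubleChains : IsHereditary doubleChains :=
  fun _ ⟨n, hn⟩ _ h => ⟨n, h.trans hn⟩

theorem inducedMatchings_subset_quasiChainGraphs : inducedMatchings ⊆ quasiChainGraphs := by
  intro G hG
  rw [mem_inducedMatchings_iff] at hG
  obtain ⟨A, B, h⟩ := exists_isBipartition_of_degree_le_one hG
  exact ⟨A, B, h,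
    exists_isGoodOrdering_of_key (fun _ => 0) fun _ _ y _ _ _ b b' hb _ hb' _ => hG y b b' hb hb',
    exists_isGoodOrdering_of_key (fun _ => 0) fun _ _ y _ _ _ b b' hb _ hb' _ => hG y b b' hb hb'⟩

theorem exists_isGoodOrdering_bipartiteComplement {V : Type*} [Finite V] {G : SimpleGraph V}
    {A B : Set V} (h : IsBipartition G A B) (hG : ∀ v a b, G.Adj v a → G.Adj v b → a = b) :
    ∃ l, IsGoodOrdering (bipartiteComplement G A B) A l := by
  have hc := isBipartition_bipartiteComplement h
  have key : ∀ x ∈ A, ∀ y ∈ A, ∀ b, (bipartiteComplement G A B).Adj y b →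
      ¬ (bipartiteComplement G A B).Adj x b → G.Adj x b := by
    intro x hx y hy b hb hxb
    rw [bipartiteComplement_adj h hx (hc.mem_right hy hb)] at hxb
    exact not_not.1 hxb
  exact exists_isGoodOrdering_of_key (fun _ => 0) fun x hx y hy _ _ b b' hb hxb hb' hxb' =>
    hG x b b' (key x hx y hy b hb hxb) (key x hx y hy b' hb' hxb')

theorem coMatchings_subset_quasiChainGraphs : coMatchings ⊆ quasiChainGraphs := by
  rintro G ⟨M, A, B, hM, h, hG⟩
  rw [ncard_neighborSet_le_one_iff] at hM
  refine ⟨A, B, ?_, ?_, ?_⟩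
  · rw [hG]
    exact isBipartition_bipartiteComplement h
  · rw [hG]
    exact exists_isGoodOrdering_bipartiteComplement h hM
  · rw [hG, bipartiteComplement_comm]
    exact exists_isGoodOrdering_bipartiteComplement h.symm hM

theorem doubleChains_subset_quasiChainGraphs : doubleChains ⊆ quasiChainGraphs := by
  rintro G ⟨n, hn⟩
  obtain ⟨φ⟩ := hn.trans ⟨(doubleChainIso n).symm.toEmbedding⟩
  have hG : ∀ u v, G.graph.Adj u v ↔ (relGraph (doubleChainRel n)).Adj (φ u) (φ v) :=
    fun u v => φ.map_adj_iff.symm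
  refine ⟨φ ⁻¹' Set.range Sum.inl, φ ⁻¹' Set.range Sum.inr,
    isBipartition_relGraph.preimage φ.toHom, ?_, ?_⟩
  -- A left neighbourhood is a final segment of indices minus one element, so increasing index is a
  -- good order. Right neighbourhoods are initial segments minus one element, so the other part is
  -- ordered by decreasing index.
  · refine exists_isGoodOrdering_of_key
      (fun v => Sum.elim (fun i => (i.1 : ℤ)) (fun i => (i.1 : ℤ)) (φ v)) ?_
    rintro x ⟨i, hi⟩ y ⟨j, hj⟩ - hxy b b' hb hxb hb' hxb'
    apply φ.injective
    rw [hG, ← hi] at hxb hxb'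
    rw [hG, ← hj] at hb hb'
    simp only [← hi, ← hj, Sum.elim_inl, Nat.cast_le] at hxy
    rcases hφb : φ b with k | k
    · simp [hφb] at hb
    · rcases hφb' : φ b' with l | l
      · simp [hφb'] at hb'
      · simp only [hφb, hφb', relGraph_inl_inr, doubleChainRel] at hb hb' hxb hxb'
        exact congrArg Sum.inr (Subtype.ext (Fin.ext (by omega)))
  · refine exists_isGoodOrdering_of_key
      (fun v => Sum.elim (fun i => -(i.1 : ℤ)) (fun i => -(i.1 : ℤ)) (φ v)) ?_
    rintro x ⟨i, hi⟩ y ⟨j, hj⟩ - hxy b b' hb hxb hb' hxb'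
    apply φ.injective
    rw [hG, ← hi] at hxb hxb'
    rw [hG, ← hj] at hb hb'
    simp only [← hi, ← hj, Sum.elim_inr, neg_le_neg_iff, Nat.cast_le] at hxy
    rcases hφb : φ b with k | k
    · rcases hφb' : φ b' with l | l
      · simp only [hφb, hφb', relGraph_inr_inl, doubleChainRel] at hb hb' hxb hxb'
        exact congrArg Sum.inl (Subtype.ext (Fin.ext (by omega)))
      · simp [hφb'] at hb'
    · simp [hφb] at hb

/-- The induced matching with `n` edges. -/
def matchingGraph (n : ℕ) : FinGraph := ⟨Fin n ⊕ Fin n, inferInstance, relGraph fun i j => i = j⟩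

/-- The bipartite complement of the induced matching with `n` edges. -/
def coMatchingGraph (n : ℕ) : FinGraph := ⟨Fin n ⊕ Fin n, inferInstance, relGraph fun i j => i ≠ j⟩

/-- The graph `D_n`, presented by its adjacency relation. -/
def doubleChainRelGraph (n : ℕ) : FinGraph :=
  ⟨DoubleChainIndex n ⊕ DoubleChainIndex n, inferInstance, relGraph (doubleChainRel n)⟩

theorem matchingGraph_mem (n : ℕ) : matchingGraph n ∈ inducedMatchings :=
  mem_inducedMatchings_iff.2 relGraph_eq_degree_le_one

theorem coMatchingGraph_mem (n : ℕ) : coMatchingGraph n ∈ coMatchings :=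
  ⟨relGraph fun i j => i = j, Set.range Sum.inl, Set.range Sum.inr,
    ncard_neighborSet_le_one_iff.2 relGraph_eq_degree_le_one, isBipartition_relGraph,
    relGraph_ne_eq_bipartiteComplement⟩

theorem doubleChainRelGraph_mem (n : ℕ) : doubleChainRelGraph n ∈ doubleChains :=
  ⟨n, ⟨(doubleChainIso n).toEmbedding⟩⟩

theorem not_isLetterGraph_matchingGraph (k : ℕ) :
    ¬ IsLetterGraph k (matchingGraph (k * k * 2 + 1)).graph := by
  intro h
  obtain ⟨i, j, hij, hadj⟩ := h.exists_adj_iff (Nat.lt_succ_self _) Sum.inl Sum.inr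
    fun _ => Sum.inl_ne_inr
  exact hij (hadj.2 (rfl : i = i))

theorem not_isLetterGraph_coMatchingGraph (k : ℕ) :
    ¬ IsLetterGraph k (coMatchingGraph (k * k * 2 + 1)).graph := by
  intro h
  obtain ⟨i, j, hij, hadj⟩ := h.exists_adj_iff (Nat.lt_succ_self _) Sum.inl Sum.inr
    fun _ => Sum.inl_ne_inr
  exact (hadj.1 hij : i ≠ i) rfl

theorem not_isLetterGraph_doubleChainRelGraph (k : ℕ) :
    ¬ IsLetterGraph k (doubleChainRelGraph (k ^ 4 + 1)).graph :=
  not_isLetterGraph_of_hasDoubleChain (f := Sum.inl) (g := Sum.inr) (fun _ _ => Sum.inl_ne_inr)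
    (Nat.lt_succ_self _) (hasDoubleChain_doubleChainRel _)

theorem exists_notMem_of_hasBoundedLettericity {X C : GraphClass} (hX : HasBoundedLettericity X)
    (hC : ∀ k, ∃ G ∈ C, ¬ IsLetterGraph k G.graph) : ∃ G ∈ C, G ∉ X := by
  obtain ⟨k, hk⟩ := hX
  obtain ⟨G, hG, hGk⟩ := hC k
  exact ⟨G, hG, fun h => hGk (isLetterGraph_of_lettericity_le (hk G h))⟩

theorem hasBoundedLettericity_of_notMem {X : GraphClass} (hX : IsHereditary X)
    (hQ : X ⊆ quasiChainGraphs) (h₁ : ∃ G ∈ inducedMatchings, G ∉ X)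
    (h₂ : ∃ G ∈ coMatchings, G ∉ X) (h₃ : ∃ G ∈ doubleChains, G ∉ X) :
    HasBoundedLettericity X := by
  obtain ⟨M, hM, hMX⟩ := h₁
  obtain ⟨C, ⟨C', S, T, hC, hST, hCC'⟩, hCX⟩ := h₂
  obtain ⟨D, ⟨n, hn⟩, hDX⟩ := h₃
  rw [mem_inducedMatchings_iff] at hM
  rw [ncard_neighborSet_le_one_iff] at hC
  -- Each of the three patterns of length `p` is long enough to contain the corresponding excluded
  -- graph.
  set p := Nat.card M.V + Nat.card C.V + n
  refine ⟨2 * exceptionBound p + 2, fun G hG => Nat.sInf_le ?_⟩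
  obtain ⟨A, B, hAB, hA, hB⟩ := hQ hG
  obtain ⟨e⟩ := hAB.nonempty_iso
  have hno : ∀ H : FinGraph, H ∉ X →
      ¬ H.graph.IsIndContained (relGraph (crossRel G.graph A B)) :=
    fun H hH hcon => hH (hX G hG H (hcon.trans ⟨e.toEmbedding⟩))
  obtain ⟨P, m, w, ⟨φ⟩⟩ := isLetterGraph_relGraph (isQuasiChainRel_crossRel hA hB) (p := p)
    (fun h => by
      obtain ⟨A', B', hM'⟩ := exists_isBipartition_of_degree_le_one hM
      exact hno M hMX (hM'.isIndContained_of_hasMatching hM (h.mono (by omega))))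
    (fun h => by
      refine hno C hCX ?_
      rw [hCC']
      exact hST.isIndContained_of_hasCoMatching hC (h.mono (by omega)))
    (fun h => hno D hDX ((hn.trans ⟨(doubleChainIso n).symm.toEmbedding⟩).trans
      (isIndContained_of_hasDoubleChain (h.mono (by omega)))))
  exact ⟨P, m, w, ⟨e.symm.trans φ⟩⟩

theorem hasBoundedLettericity_iff {X : GraphClass} (hX : IsHereditary X)
    (hQ : X ⊆ quasiChainGraphs) :
    HasBoundedLettericity X ↔ (∃ G ∈ inducedMatchings, G ∉ X) ∧ (∃ G ∈ coMatchings, G ∉ X) ∧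
      (∃ G ∈ doubleChains, G ∉ X) :=
  ⟨fun h => ⟨exists_notMem_of_hasBoundedLettericity h
      fun k => ⟨_, matchingGraph_mem _, not_isLetterGraph_matchingGraph k⟩,
    exists_notMem_of_hasBoundedLettericity h
      fun k => ⟨_, coMatchingGraph_mem _, not_isLetterGraph_coMatchingGraph k⟩,
    exists_notMem_of_hasBoundedLettericity h
      fun k => ⟨_, doubleChainRelGraph_mem _, not_isLetterGraph_doubleChainRelGraph k⟩⟩,
    fun h => hasBoundedLettericity_of_notMem hX hQ h.1 h.2.1 h.2.2⟩

end Classes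

/-! ### None of the three classes contains another. -/

section Incomparable

/-- The bipartition is not unique, as each edge may be turned round independently, but this does not
affect the pattern. -/
theorem hasMatching_crossRel_matchingGraph {n : ℕ} {A B : Set (Fin n ⊕ Fin n)}
    (h : IsBipartition (matchingGraph n).graph A B) :
    HasMatching (crossRel (matchingGraph n).graph A B) n := by
  have hex : ∀ i : Fin n, ∃ (s : A) (t : B),
      (s.1 = Sum.inl i ∧ t.1 = Sum.inr i) ∨ (s.1 = Sum.inr i ∧ t.1 = Sum.inl i) := by
    intro i
    have hadj : (matchingGraph n).graph.Adj (Sum.inl i) (Sum.inr i) := (rfl : i = i)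
    rcases h.1.mem_of_adj hadj with ⟨h1, h2⟩ | ⟨h1, h2⟩
    · exact ⟨⟨_, h1⟩, ⟨_, h2⟩, Or.inl ⟨rfl, rfl⟩⟩
    · exact ⟨⟨_, h2⟩, ⟨_, h1⟩, Or.inr ⟨rfl, rfl⟩⟩
  choose s t hst using hex
  refine ⟨s, t, fun i j => ?_⟩
  constructor
  · intro hadj
    change (relGraph fun i j : Fin n => i = j).Adj (s i).1 (t j).1 at hadj
    rcases hst i with ⟨h1, -⟩ | ⟨h1, -⟩ <;> rcases hst j with ⟨-, h2⟩ | ⟨-, h2⟩ <;>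
      rw [h1, h2] at hadj <;> simp at hadj <;> simp [hadj]
  · rintro rfl
    change (relGraph fun i j : Fin n => i = j).Adj (s i).1 (t i).1
    rcases hst i with ⟨h1, h2⟩ | ⟨h1, h2⟩ <;> rw [h1, h2] <;> simp

/-- This graph is a 6-cycle, so its bipartition is unique up to exchanging the parts. -/
theorem hasCoMatching_crossRel_coMatchingGraph {A B : Set (Fin 3 ⊕ Fin 3)}
    (h : IsBipartition (coMatchingGraph 3).graph A B) :
    HasCoMatching (crossRel (coMatchingGraph 3).graph A B) 3 := by
  have main : ∀ A B : Set (Fin 3 ⊕ Fin 3),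
      IsBipartition (coMatchingGraph 3).graph A B → Sum.inl 0 ∈ A →
      (∀ i, Sum.inl i ∈ A) ∧ ∀ i, Sum.inr i ∈ B := by
    intro A B h h0
    have hadj : ∀ i j : Fin 3, i ≠ j →
        (coMatchingGraph 3).graph.Adj (Sum.inl i) (Sum.inr j) := fun i j hij => hij
    have hr : ∀ i : Fin 3, i ≠ 0 → Sum.inr i ∈ B :=
      fun i hi => h.mem_right h0 (hadj 0 i hi.symm)
    have hl : ∀ i, Sum.inl i ∈ A := by
      intro i
      rcases eq_or_ne i 1 with rfl | hi
      · exact h.symm.mem_right (hr 2 (by decide))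
          (hadj 1 2 (by decide)).symm
      · exact h.symm.mem_right (hr 1 (by decide)) (hadj i 1 hi).symm
    refine ⟨hl, fun i => ?_⟩
    rcases eq_or_ne i 0 with rfl | hi
    · exact h.mem_right (hl 1) (hadj 1 0 (by decide))
    · exact hr i hi
  rcases h.mem_or_mem (Sum.inl 0) with h0 | h0
  · obtain ⟨hl, hr⟩ := main A B h h0
    exact ⟨fun i => ⟨Sum.inl i, hl i⟩, fun i => ⟨Sum.inr i, hr i⟩, fun i j => Iff.rfl⟩
  · obtain ⟨hl, hr⟩ := main B A h.symm h0
    exact ⟨fun i => ⟨Sum.inr i, hr i⟩, fun i => ⟨Sum.inl i, hl i⟩,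
      fun i j => ne_comm (a := j) (b := i)⟩

/-- Let `f 0` have the least index. The indices of `g 1` and `g 2` are no smaller than it, so
non-adjacency makes both equal to that index plus one, and `g 1 = g 2`. -/
theorem not_hasMatching_doubleChainRel (n : ℕ) : ¬ HasMatching (doubleChainRel n) 3 := by
  rintro ⟨f, g, h⟩
  have h00 := h 0 0
  have h01 := h 0 1
  have h02 := h 0 2
  have h10 := h 1 0
  have h11 := h 1 1
  have h12 := h 1 2
  have h20 := h 2 0
  have h21 := h 2 1
  have h22 := h 2 2
  simp [doubleChainRel, Fin.ext_iff, -not_and, -Fin.val_fin_le]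
    at h00 h01 h02 h10 h11 h12 h20 h21 h22
  omega

/-- In terms of indices, let `f 2` be the greatest. For `i = 0, 1`, adjacency to `f 2` gives `g i ≥
f 2 ≥ f i`, so non-adjacency to `f i` gives `g i = f i + 1`. As `g i ≠ f 2 + 1`, this forces `f i =
f 2 - 1` for both, contradicting that `f 0` is adjacent to `g 1`. -/
theorem not_hasCoMatching_doubleChainRel (n : ℕ) : ¬ HasCoMatching (doubleChainRel n) 3 := by
  rintro ⟨f, g, h⟩
  have h00 := h 0 0
  have h01 := h 0 1
  have h02 := h 0 2
  have h10 := h 1 0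
  have h11 := h 1 1
  have h12 := h 1 2
  have h20 := h 2 0
  have h21 := h 2 1
  have h22 := h 2 2
  simp [doubleChainRel, Fin.ext_iff, -not_and, -Fin.val_fin_le]
    at h00 h01 h02 h10 h11 h12 h20 h21 h22
  omega

/-- A double chain graph has a bipartition whose relation embeds into the relation of `D_n`. -/
theorem exists_isBipartition_of_mem_doubleChains {G : FinGraph} (hG : G ∈ doubleChains) :
    ∃ (n : ℕ) (A B : Set G.V) (f : A → DoubleChainIndex n) (g : B → DoubleChainIndex n),
      IsBipartition G.graph A B ∧
        ∀ a b, crossRel G.graph A B a b ↔ doubleChainRel n (f a) (g b) := by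
  obtain ⟨n, hn⟩ := hG
  obtain ⟨φ⟩ := hn.trans ⟨(doubleChainIso n).symm.toEmbedding⟩
  have hf : ∀ a : φ ⁻¹' Set.range Sum.inl, ∃ i, Sum.inl i = φ a := fun a => a.2
  have hg : ∀ b : φ ⁻¹' Set.range Sum.inr, ∃ i, Sum.inr i = φ b := fun b => b.2
  choose f hf using hf
  choose g hg using hg
  refine ⟨n, _, _, f, g, isBipartition_relGraph.preimage φ.toHom, fun a b => ?_⟩
  rw [← relGraph_inl_inr (R := doubleChainRel n), hf, hg, φ.map_adj_iff]

theorem matchingGraph_notMem_doubleChains : matchingGraph 3 ∉ doubleChains := by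
  intro h
  obtain ⟨n, A, B, f, g, hAB, hfg⟩ := exists_isBipartition_of_mem_doubleChains h
  obtain ⟨s, t, hst⟩ := hasMatching_crossRel_matchingGraph hAB
  exact not_hasMatching_doubleChainRel n ⟨f ∘ s, g ∘ t, fun i j => (hfg _ _).symm.trans (hst i j)⟩

theorem coMatchingGraph_notMem_doubleChains : coMatchingGraph 3 ∉ doubleChains := by
  intro h
  obtain ⟨n, A, B, f, g, hAB, hfg⟩ := exists_isBipartition_of_mem_doubleChains h
  obtain ⟨s, t, hst⟩ := hasCoMatching_crossRel_coMatchingGraph hAB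
  exact not_hasCoMatching_doubleChainRel n
    ⟨f ∘ s, g ∘ t, fun i j => (hfg _ _).symm.trans (hst i j)⟩

/-- In the bipartite complement of a graph of maximum degree one, a vertex has at most one
non-neighbour on the other side. -/
theorem exists_isBipartition_of_mem_coMatchings {G : FinGraph} (hG : G ∈ coMatchings) :
    ∃ A B, IsBipartition G.graph A B ∧
      (∀ u ∈ A, ∀ v ∈ B, ∀ w ∈ B, ¬ G.graph.Adj u v → ¬ G.graph.Adj u w → v = w) ∧
      (∀ u ∈ B, ∀ v ∈ A, ∀ w ∈ A, ¬ G.graph.Adj u v → ¬ G.graph.Adj u w → v = w) := by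
  obtain ⟨M, A, B, hM, h, hG⟩ := hG
  rw [ncard_neighborSet_le_one_iff] at hM
  rw [hG]
  refine ⟨A, B, isBipartition_bipartiteComplement h, fun u hu v hv w hw huv huw => ?_,
    fun u hu v hv w hw huv huw => ?_⟩
  · rw [bipartiteComplement_adj h hu hv, not_not] at huv
    rw [bipartiteComplement_adj h hu hw, not_not] at huw
    exact hM u v w huv huw
  · rw [bipartiteComplement_comm, bipartiteComplement_adj h.symm hu hv, not_not] at huv
    rw [bipartiteComplement_comm, bipartiteComplement_adj h.symm hu hw, not_not] at huw
    exact hM u v w huv huw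

theorem matchingGraph_notMem_coMatchings : matchingGraph 3 ∉ coMatchings := by
  intro h
  obtain ⟨A, B, hAB, hA, -⟩ := exists_isBipartition_of_mem_coMatchings h
  obtain ⟨s, t, hst⟩ := hasMatching_crossRel_matchingGraph hAB
  have h12 : t 1 = t 2 := Subtype.ext (hA (s 0) (s 0).2 (t 1) (t 1).2 (t 2) (t 2).2
    (mt (hst 0 1).1 (by decide)) (mt (hst 0 2).1 (by decide)))
  have h11 := (hst 1 1).2 rfl
  rw [h12, hst] at h11
  exact absurd h11 (by decide)

theorem coMatchingGraph_notMem_inducedMatchings : coMatchingGraph 3 ∉ inducedMatchings := by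
  rw [mem_inducedMatchings_iff]
  intro h
  exact absurd (Sum.inr_injective (h (Sum.inl 0) (Sum.inr 1) (Sum.inr 2)
    (by simp [coMatchingGraph]) (by simp [coMatchingGraph]))) (by decide)

theorem doubleChainRelGraph_notMem_inducedMatchings :
    doubleChainRelGraph 3 ∉ inducedMatchings := by
  rw [mem_inducedMatchings_iff]
  intro h
  exact absurd (Sum.inr_injective (h (Sum.inl ⟨0, by decide⟩) (Sum.inr ⟨0, by decide⟩)
    (Sum.inr ⟨3, by decide⟩) (by simp [doubleChainRelGraph, doubleChainRel])
    (by simp [doubleChainRelGraph, doubleChainRel]))) (by decide)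

theorem doubleChainRelGraph_notMem_coMatchings : doubleChainRelGraph 3 ∉ coMatchings := by
  intro h
  obtain ⟨A, B, hAB, hA, hB⟩ := exists_isBipartition_of_mem_coMatchings h
  have main : ∀ A B, IsBipartition (doubleChainRelGraph 3).graph A B →
      (∀ u ∈ A, ∀ v ∈ B, ∀ w ∈ B, ¬ (doubleChainRelGraph 3).graph.Adj u v →
        ¬ (doubleChainRelGraph 3).graph.Adj u w → v = w) →
      Sum.inl ⟨0, by decide⟩ ∉ A := by
    intro A B hAB hA h0
    -- Adjacencies fix the sides of the vertices involved; left vertex 6 then has the two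
    -- non-neighbours 0 and 3 on the other side.
    have h1 : Sum.inr ⟨0, by decide⟩ ∈ B :=
      hAB.mem_right h0 (by simp [doubleChainRelGraph, doubleChainRel])
    have h2 : Sum.inr ⟨3, by decide⟩ ∈ B :=
      hAB.mem_right h0 (by simp [doubleChainRelGraph, doubleChainRel])
    have h3 : Sum.inr ⟨6, by decide⟩ ∈ B :=
      hAB.mem_right h0 (by simp [doubleChainRelGraph, doubleChainRel])
    have h4 : Sum.inl ⟨6, by decide⟩ ∈ A :=
      hAB.symm.mem_right h3 (by simp [doubleChainRelGraph, doubleChainRel])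
    exact absurd (Sum.inr_injective (hA _ h4 _ h1 _ h2
      (by simp [doubleChainRelGraph, doubleChainRel])
      (by simp [doubleChainRelGraph, doubleChainRel]))) (by decide)
  exact (hAB.mem_or_mem _).elim (main A B hAB hA) (main B A hAB.symm hB)

end Incomparable

theorem theorem5p1 :
    (∀ X : GraphClass, IsHereditary X → X ⊆ quasiChainGraphs →
      (HasBoundedLettericity X ↔
        (∃ G ∈ inducedMatchings, G ∉ X) ∧ (∃ G ∈ coMatchings, G ∉ X) ∧
          (∃ G ∈ doubleChains, G ∉ X))) ∧
    {X : GraphClass | X ⊆ quasiChainGraphs ∧ IsMinimalUnbounded X} =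
      {inducedMatchings, coMatchings, doubleChains} := by
  have hunb : ∀ X : GraphClass, IsHereditary X → X ⊆ quasiChainGraphs →
      (inducedMatchings ⊆ X ∨ coMatchings ⊆ X ∨ doubleChains ⊆ X) → ¬ HasBoundedLettericity X := by
    intro X hX hQ h hb
    obtain ⟨⟨G, hG, hGX⟩, ⟨H, hH, hHX⟩, ⟨K, hK, hKX⟩⟩ := (hasBoundedLettericity_iff hX hQ).1 hb
    rcases h with h | h | h
    · exact hGX (h hG)
    · exact hHX (h hH)
    · exact hKX (h hK)
  have hM : IsMinimalUnbounded inducedMatchings :=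
    ⟨isHereditary_inducedMatchings, hunb _ isHereditary_inducedMatchings
      inducedMatchings_subset_quasiChainGraphs (Or.inl subset_rfl), fun Y hY hlt =>
      hasBoundedLettericity_of_notMem hY (hlt.1.trans inducedMatchings_subset_quasiChainGraphs)
        (Set.not_subset.1 hlt.2)
        ⟨_, coMatchingGraph_mem 3, fun h => coMatchingGraph_notMem_inducedMatchings (hlt.1 h)⟩
        ⟨_, doubleChainRelGraph_mem 3,
          fun h => doubleChainRelGraph_notMem_inducedMatchings (hlt.1 h)⟩⟩
  have hC : IsMinimalUnbounded coMatchings :=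
    ⟨isHereditary_coMatchings, hunb _ isHereditary_coMatchings
      coMatchings_subset_quasiChainGraphs (Or.inr (Or.inl subset_rfl)), fun Y hY hlt =>
      hasBoundedLettericity_of_notMem hY (hlt.1.trans coMatchings_subset_quasiChainGraphs)
        ⟨_, matchingGraph_mem 3, fun h => matchingGraph_notMem_coMatchings (hlt.1 h)⟩
        (Set.not_subset.1 hlt.2)
        ⟨_, doubleChainRelGraph_mem 3,
          fun h => doubleChainRelGraph_notMem_coMatchings (hlt.1 h)⟩⟩
  have hD : IsMinimalUnbounded doubleChains :=
    ⟨isHereditary_doubleChains, hunb _ isHereditary_doubleChains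
      doubleChains_subset_quasiChainGraphs (Or.inr (Or.inr subset_rfl)), fun Y hY hlt =>
      hasBoundedLettericity_of_notMem hY (hlt.1.trans doubleChains_subset_quasiChainGraphs)
        ⟨_, matchingGraph_mem 3, fun h => matchingGraph_notMem_doubleChains (hlt.1 h)⟩
        ⟨_, coMatchingGraph_mem 3, fun h => coMatchingGraph_notMem_doubleChains (hlt.1 h)⟩
        (Set.not_subset.1 hlt.2)⟩
  refine ⟨fun X hX hQ => hasBoundedLettericity_iff hX hQ, Set.Subset.antisymm ?_ ?_⟩
  · rintro X ⟨hQ, hX, hXu, hmin⟩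
    -- A minimal class containing one of the three equals it, and an unbounded class must contain
    -- one of them.
    have heq : ∀ C : GraphClass, IsMinimalUnbounded C → C ⊆ X → X = C := by
      intro C hCm hCX
      by_contra hne
      exact hCm.2.1 (hmin C hCm.1 (hCX.ssubset_of_ne (Ne.symm hne)))
    rw [Set.mem_insert_iff, Set.mem_insert_iff, Set.mem_singleton_iff]
    by_contra! hne
    exact hXu (hasBoundedLettericity_of_notMem hX hQ
      (Set.not_subset.1 fun h => hne.1 (heq _ hM h))
      (Set.not_subset.1 fun h => hne.2.1 (heq _ hC h))
      (Set.not_subset.1 fun h => hne.2.2 (heq _ hD h)))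
  · rintro X (rfl | rfl | rfl)
    · exact ⟨inducedMatchings_subset_quasiChainGraphs, hM⟩
    · exact ⟨coMatchings_subset_quasiChainGraphs, hC⟩
    · exact ⟨doubleChains_subset_quasiChainGraphs, hD⟩
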